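/- For an entire function $f$ put $f^*(z)=\overline{f(\bar z)}$. Let $\mathcal{HB}$ be the class of entire functions $E$ with $|E(\bar z)|<|E(z)|$ whenever $\operatorname{Im} z>0$. For $E\in\mathcal{HB}$, the de Branges space $\mathcal H(E)$ is the set of all entire $f$ with $\|f\|_E^2:=\int_{\mathbb R}|f(t)/E(t)|^2\,dt<\infty$ such that $f/E$ and $f^*/E$ are of bounded type in the open upper half-plane (quotients of two bounded analytic functions, with denominator not identically zero) and have nonpositive mean type there, the mean type of $g$ being $\limsup_{y\to+\infty} y^{-1}\log|g(iy)|$. Its reproducing kernel is $$K_E(w,z)=\frac{\overline{E(w)}E(z)-E(\bar w)E^*(z)}{2\pi i(\bar w-z)},$$ extended continuously to $z=\bar w$. For $E\in\mathcal{HB}$ without real zeros, a phase function of $E$ is a continuous strictly increasing $\varphi_E:\mathbb R\to\mathbb R$ with $E(x)=|E(x)|e^{-i\varphi_E(x)}$ for all $x\in\mathbb R$; it is unique up to an additive constant in $2\pi\mathbb Z$. Let $E_0,E,F\in\mathcal{HB}$ have no real zeros. Assume that 1. $\mathcal H(E_0)=\mathcal H(E)$, that is, the two spaces coincide as sets and their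 norms are equivalent; 2. there is $C>0$ with $\varphi_F'(x)\le C\,\varphi_E'(x)$ for all $x\in\mathbb R$; 3. there are $a,b>0$ with $a\le K_{E_0}(x,x)\le b$ for all $x\in\mathbb R$. Then all zeros of $EF+E^*F^*$ are real, and its zero set $\Lambda$ is a (non-normalized) sampling sequence for $\mathcal H(E_0)$: there are constants $A,B>0$ such that for all $f\in\mathcal H(E_0)$ $$A\|f\|_{E_0}^2\le\sum_{\lambda\in\Lambda}|f(\lambda)|^2\le B\|f\|_{E_0}^2 .$$ -/

import Mathlib

open Filter Topology MeasureTheory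
open scoped ComplexConjugate

noncomputable section

namespace DeBranges

/-- The function `f*`, given by `f*(z) = conj (f (conj z))`. -/
def sharp (f : ℂ → ℂ) (z : ℂ) : ℂ := conj (f (conj z))

/-- The Hermite-Biehler class: entire functions `E` with `|E(conj z)| < |E(z)|` on the open
upper half-plane. -/
structure IsHermiteBiehler (E : ℂ → ℂ) : Prop where
  entire : Differentiable ℂ E
  norm_lt : ∀ z : ℂ, 0 < z.im → ‖E (conj z)‖ < ‖E z‖

/-- The open upper half-plane, as a subset of `ℂ`. -/
def upperHalf : Set ℂ := {z : ℂ | 0 < z.im}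

/-- `f` is analytic in the open upper half-plane and of bounded type there: it is a quotient
`p / q` of two bounded analytic functions, with `q` not identically zero. -/
def IsBoundedType (f : ℂ → ℂ) : Prop :=
  DifferentiableOn ℂ f upperHalf ∧
    ∃ p q : ℂ → ℂ, DifferentiableOn ℂ p upperHalf ∧ DifferentiableOn ℂ q upperHalf ∧
      (∃ M : ℝ, ∀ z ∈ upperHalf, ‖p z‖ ≤ M) ∧ (∃ M : ℝ, ∀ z ∈ upperHalf, ‖q z‖ ≤ M) ∧
      (∃ z ∈ upperHalf, q z ≠ 0) ∧ ∀ z ∈ upperHalf, f z * q z = p z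

/-- The mean type `limsup_{y → +∞} log |f(iy)| / y`, in `[-∞, +∞]`, with `log 0 = -∞`. -/
def meanType (f : ℂ → ℂ) : EReal :=
  limsup (fun y : ℝ => ENNReal.log ‖f (Complex.I * (y : ℂ))‖ₑ / (y : EReal)) atTop

/-- The squared norm `∫_ℝ |f(t) / E(t)|² dt`. -/
def normSq (E f : ℂ → ℂ) : ℝ := ∫ t : ℝ, ‖f (t : ℂ) / E (t : ℂ)‖ ^ 2

/-- The de Branges space `H(E)`, as a set of entire functions. -/
def space (E : ℂ → ℂ) : Set (ℂ → ℂ) :=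
  {f | Differentiable ℂ f ∧
    Integrable (fun t : ℝ => ‖f (t : ℂ) / E (t : ℂ)‖ ^ 2) ∧
    (IsBoundedType (fun z => f z / E z) ∧ meanType (fun z => f z / E z) ≤ 0) ∧
    (IsBoundedType (fun z => sharp f z / E z) ∧ meanType (fun z => sharp f z / E z) ≤ 0)}

/-- `H(E₁) = H(E₂)`: the two spaces coincide as sets and their norms are equivalent. -/
def SameSpace (E₁ E₂ : ℂ → ℂ) : Prop :=
  space E₁ = space E₂ ∧
    ∃ a b : ℝ, 0 < a ∧ 0 < b ∧
      ∀ f ∈ space E₁, a * normSq E₁ f ≤ normSq E₂ f ∧ normSq E₂ f ≤ b * normSq E₁ f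

/-- The reproducing kernel
`K_E(w, z) = (conj E(w) E(z) - E(conj w) E*(z)) / (2 π i (conj w - z))`,
extended by its limit to the removable singularity `z = conj w`. -/
def kernel (E : ℂ → ℂ) (w z : ℂ) : ℂ :=
  if z = conj w then
    -deriv (fun u => conj (E w) * E u - E (conj w) * sharp E u) z / (2 * Real.pi * Complex.I)
  else
    (conj (E w) * E z - E (conj w) * sharp E z) / (2 * Real.pi * Complex.I * (conj w - z))

/-- `φ` is a phase function of `E`: it is continuous and strictly increasing, and
`E(x) = |E(x)| exp(-i φ(x))` for all real `x`. -/
structure IsPhaseFunction (E : ℂ → ℂ) (φ : ℝ → ℝ) : Prop where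
  continuous : Continuous φ
  strictMono : StrictMono φ
  eq_norm_mul_exp : ∀ x : ℝ, E x = (‖E x‖ : ℂ) * Complex.exp (-(Complex.I * (φ x : ℂ)))

/-- The family `(s n)` of real points is a (non-normalized) sampling sequence for `H(E)`. -/
def IsSamplingSequence (E : ℂ → ℂ) {ι : Type*} (s : ι → ℝ) : Prop :=
  ∃ A B : ℝ, 0 < A ∧ 0 < B ∧ ∀ f ∈ space E,
    Summable (fun n => ‖f (s n : ℂ)‖ ^ 2) ∧
      A * normSq E f ≤ ∑' n, ‖f (s n : ℂ)‖ ^ 2 ∧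
      ∑' n, ‖f (s n : ℂ)‖ ^ 2 ≤ B * normSq E f

end DeBranges

end

/-!
Put `G = EF` and `A = G + G*`. The map `g ↦ g / G` embeds `H(G)` as a closed subspace of `L²(ℝ)`,
and `K_G(x, ·)` and `K_G(y, ·)` are orthogonal at distinct zeros `x`, `y` of `A`, so the normalized
kernels at the zeros of `A` form an orthonormal system. By a Liouville argument, a function of
`H(G)` vanishing on all zeros of `A` is a multiple of `A`: the orthogonal complement of the system
is at most one-dimensional.

Multiplication by `F` embeds `H(E)` isometrically in `H(G)`, and its image does not contain `A`:
if `fF = A`, then `(f*/E - E*/E) (F*/F) = 1` in the upper half-plane, whereas the Smirnov maximum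
principle bounds the first factor by `1` and `|F*/F| < 1`. A closed subspace meeting a
finite-dimensional one trivially is bounded away from it, so Parseval's identity gives a lower frame
bound on the image of `H(E)`, while Bessel's inequality gives the upper one. Finally
`K_G(x, x) = |F(x)|² K_E(x, x) + |E(x)|² K_F(x, x)` and `π K_E(x, x) = φ_E'(x) |E(x)|²`, so the
phase condition makes `K_G(x, x)` comparable with `|F(x)|²` and the frame inequality becomes the
sampling inequality.
-/

namespace DeBranges

section Disc

open Metric

/-- In contrast to `Complex.norm_le_of_forall_mem_frontier_norm_le`, `f` need not extend
continuously to the boundary. -/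
theorem norm_le_of_eventually_frontier {D : Set ℂ} (hDo : IsOpen D) (hDb : Bornology.IsBounded D)
    {f : ℂ → ℂ} (hf : DifferentiableOn ℂ f D) {C : ℝ}
    (hbd : ∀ ζ ∈ frontier D, ∀ᶠ z in 𝓝[D] ζ, ‖f z‖ ≤ C) {z : ℂ} (hz : z ∈ D) : ‖f z‖ ≤ C := by
  by_contra! hlt
  set U : Set ℂ := {x ∈ D | C < ‖f x‖}
  have hUo : IsOpen U := hf.continuousOn.norm.isOpen_inter_preimage hDo isOpen_Ioi
  have hUD : closure U ⊆ D := by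
    intro x hx
    by_contra hxD
    have hfr : x ∈ frontier D := by
      rw [frontier, hDo.interior_eq]
      exact ⟨closure_mono (Set.sep_subset _ _) hx, hxD⟩
    obtain ⟨y, hyU, hy⟩ :=
      ((mem_closure_iff_frequently.1 hx).and_eventually
        (eventually_nhdsWithin_iff.1 (hbd x hfr))).exists
    exact hyU.2.not_ge (hy hyU.1)
  have hdiff : DiffContOnCl ℂ f U := (hf.mono hUD).diffContOnCl
  refine hlt.not_ge (Complex.norm_le_of_forall_mem_frontier_norm_le
    (hDb.subset (Set.sep_subset _ _)) hdiff (fun x hx => ?_) (subset_closure ⟨hz, hlt⟩))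
  have hxU : x ∉ U := hUo.interior_eq ▸ hx.2
  exact not_lt.1 fun h => hxU ⟨hUD hx.1, h⟩

theorem harnack {u : ℂ → ℝ} {r : ℝ} (hu : InnerProductSpace.HarmonicOnNhd u (closedBall 0 r))
    (hu0 : ∀ z ∈ sphere (0 : ℂ) r, 0 ≤ u z) {a : ℂ} (ha : ‖a‖ < r) :
    (r - ‖a‖) * u 0 ≤ (r + ‖a‖) * u a ∧ (r - ‖a‖) * u a ≤ (r + ‖a‖) * u 0 := by
  have hr : 0 < r := (norm_nonneg a).trans_lt ha
  have hab : a ∈ ball (0 : ℂ) r := by simpa using ha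
  have hcont : ContinuousOn u (sphere 0 |r|) := fun z hz =>
    (hu z (sphere_subset_closedBall (by rwa [abs_of_pos hr] at hz))).1.continuousAt
      |>.continuousWithinAt
  set P : ℂ → ℝ := (Complex.re ∘ herglotzRieszKernel 0 a) • u
  have hP : CircleIntegrable P 0 r := ContinuousOn.circleIntegrable'
    ((Complex.continuous_re.comp_continuousOn
      (continuousOn_herglotzRieszKernel_sphere hab)).smul hcont)
  have hPa : Real.circleAverage P 0 r = u a := hu.circleAverage_re_herglotzRieszKernel_smul hab
  have hu_zero : Real.circleAverage u 0 r = u 0 :=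
    InnerProductSpace.HarmonicOnNhd.circleAverage_eq (by rwa [abs_of_pos hr])
  have hint (c : ℝ) : CircleIntegrable (fun z => c • u z) 0 r :=
    (hcont.const_smul c).circleIntegrable'
  have hlow : (r - ‖a‖) / (r + ‖a‖) * u 0 ≤ u a := by
    rw [← hPa, ← hu_zero, ← smul_eq_mul, ← Real.circleAverage_fun_smul]
    refine Real.circleAverage_mono (hint _) hP fun z hz => ?_
    rw [abs_of_pos hr] at hz
    refine mul_le_mul_of_nonneg_right ?_ (hu0 z hz)
    simpa [herglotzRieszKernel_def] using le_re_herglotzRieszKernel hz hab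
  have hupp : u a ≤ (r + ‖a‖) / (r - ‖a‖) * u 0 := by
    rw [← hPa, ← hu_zero, ← smul_eq_mul, ← Real.circleAverage_fun_smul]
    refine Real.circleAverage_mono hP (hint _) fun z hz => ?_
    rw [abs_of_pos hr] at hz
    refine mul_le_mul_of_nonneg_right ?_ (hu0 z hz)
    simpa [herglotzRieszKernel_def] using re_herglotzRieszKernel_le hz hab
  have hsub : 0 < r - ‖a‖ := sub_pos.2 ha
  rw [div_mul_eq_mul_div, div_le_iff₀ (by positivity)] at hlow
  rw [div_mul_eq_mul_div, le_div_iff₀ hsub] at hupp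
  constructor <;> linarith

theorem exists_div_canonical_factor {χ : ℂ → ℂ} {U : Set ℂ} {r : ℝ} (hU : IsOpen U)
    (hrU : closedBall 0 r ⊆ U) (hχ : DifferentiableOn ℂ χ U) {w : ℂ} (hw : w ∈ ball 0 r)
    (hχw : χ w = 0) :
    ∃ χ₁ : ℂ → ℂ, DifferentiableOn ℂ χ₁ U ∧ (∀ z ∈ sphere 0 r, ‖χ₁ z‖ = ‖χ z‖) ∧
      ‖χ 0‖ = ‖χ₁ 0‖ * (‖w‖ / r) := by
  have hr : 0 < r := pos_of_mem_ball hw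
  have hdslope (z : ℂ) : χ z = (z - w) * dslope χ w z := by
    simpa [hχw] using (sub_smul_dslope χ w z).symm
  refine ⟨fun z => dslope χ w z * ((r ^ 2 - conj w * z) / r), ?_, fun z hz => ?_, ?_⟩
  · exact ((Complex.differentiableOn_dslope
      (hU.mem_nhds (hrU (ball_subset_closedBall hw)))).2 hχ).mul (by fun_prop)
  · have hzw : z - w ≠ 0 := by
      rintro h
      rw [sub_eq_zero.1 h] at hz
      simp_all
    have h1 := Complex.norm_canonicalFactor_eval_circle_eq_one hw hz
    rw [Complex.canonicalFactor_apply, ← div_div, norm_div,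
      div_eq_one_iff_eq (norm_ne_zero_iff.2 hzw)] at h1
    rw [norm_mul, h1, hdslope z, norm_mul, mul_comm]
  · rw [hdslope 0]
    simp only [zero_sub, norm_mul, norm_neg, mul_zero, sub_zero, norm_div, norm_pow,
      Complex.norm_real, Real.norm_of_nonneg hr.le]
    field_simp

theorem exists_ne_zero_norm_eq_on_sphere {χ : ℂ → ℂ} {U : Set ℂ} {s r : ℝ} (hU : IsOpen U)
    (hrU : closedBall 0 r ⊆ U) (hχ : DifferentiableOn ℂ χ U) (hs : 0 ≤ s) (hsr : s < r)
    (h0 : χ 0 ≠ 0) :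
    ∃ χ₁ : ℂ → ℂ, DifferentiableOn ℂ χ₁ U ∧ (∀ z ∈ sphere 0 r, ‖χ₁ z‖ = ‖χ z‖) ∧
      (∀ z ∈ closedBall 0 s, χ₁ z ≠ 0) ∧ ‖χ 0‖ ≤ ‖χ₁ 0‖ := by
  have hr : 0 < r := hs.trans_lt hsr
  obtain ⟨M, hM⟩ := (isCompact_sphere (0 : ℂ) r).exists_bound_of_continuousOn
    (hχ.continuousOn.mono (sphere_subset_closedBall.trans hrU))
  obtain ⟨n, hn⟩ : ∃ n : ℕ, M * (s / r) ^ n < ‖χ 0‖ := by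
    have : Tendsto (fun n : ℕ => M * (s / r) ^ n) atTop (𝓝 (M * 0)) :=
      (tendsto_pow_atTop_nhds_zero_of_lt_one (by positivity) ((div_lt_one hr).2 hsr)).const_mul M
    rw [mul_zero] at this
    exact (this.eventually_lt_const (norm_pos_iff.2 h0)).exists
  induction n generalizing χ with
  | zero =>
    refine absurd (Complex.norm_le_of_forall_mem_frontier_norm_le isBounded_ball
      ((hχ.mono (closure_ball_subset_closedBall.trans hrU)).diffContOnCl) (fun z hz => ?_)
      (subset_closure (mem_ball_self hr))) (by simpa using hn)
    exact hM z (frontier_ball_subset_sphere hz)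
  | succ n ih =>
    by_cases hz : ∀ z ∈ closedBall (0 : ℂ) s, χ z ≠ 0
    · exact ⟨χ, hχ, fun _ _ => rfl, hz, le_rfl⟩
    push Not at hz
    obtain ⟨w, hw, hχw⟩ := hz
    have hws : ‖w‖ ≤ s := by simpa using hw
    obtain ⟨χ₁, hd, hsphere, hzero⟩ := exists_div_canonical_factor hU hrU hχ
      (closedBall_subset_ball hsr hw) hχw
    have hle : ‖χ 0‖ ≤ ‖χ₁ 0‖ * (s / r) := by rw [hzero]; gcongr
    have hpos : 0 < ‖χ 0‖ := norm_pos_iff.2 h0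
    have hs0 : 0 < s / r := pos_of_mul_pos_right (hpos.trans_le hle) (norm_nonneg _)
    have hχ₁ : ‖χ 0‖ ≤ ‖χ₁ 0‖ := hle.trans
      (mul_le_of_le_one_right (norm_nonneg _) ((div_le_one hr).2 hsr.le))
    obtain ⟨χ₂, hd₂, hsphere₂, hne₂, hzero₂⟩ := ih hd (norm_pos_iff.1 (hpos.trans_le hχ₁))
      (fun z hz => (hsphere z hz).trans_le (hM z hz))
      (lt_of_mul_lt_mul_right (by rw [mul_assoc, ← pow_succ]; linarith) hs0.le)
    exact ⟨χ₂, hd₂, fun z hz => (hsphere₂ z hz).trans (hsphere z hz), hne₂, hχ₁.trans hzero₂⟩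

theorem sub_mul_log_norm_le_of_mul_le_one {ψ χ : ℂ → ℂ} {U : Set ℂ} {s r : ℝ} (hU : IsOpen U)
    (hrU : closedBall 0 r ⊆ U) (hψ : DifferentiableOn ℂ ψ U) (hχ : DifferentiableOn ℂ χ U)
    (hχ1 : ∀ z ∈ sphere (0 : ℂ) r, ‖χ z‖ ≤ 1) (hψχ : ∀ z ∈ sphere (0 : ℂ) r, ‖ψ z * χ z‖ ≤ 1)
    (h0 : χ 0 ≠ 0) (hsr : s < r) {a : ℂ} (ha : ‖a‖ < s) :
    (s - ‖a‖) * Real.log ‖ψ a‖ ≤ (s + ‖a‖) * -Real.log ‖χ 0‖ := by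
  have hs : 0 < s := (norm_nonneg a).trans_lt ha
  obtain ⟨χ₁, hd, hsphere, hne, hzero⟩ := exists_ne_zero_norm_eq_on_sphere hU hrU hχ hs.le hsr h0
  have hmax {f : ℂ → ℂ} (hf : DifferentiableOn ℂ f U) (hf1 : ∀ z ∈ sphere (0 : ℂ) r, ‖f z‖ ≤ 1)
      {z : ℂ} (hz : z ∈ closedBall 0 s) : ‖f z‖ ≤ 1 :=
    Complex.norm_le_of_forall_mem_frontier_norm_le isBounded_ball
      (hf.mono (closure_ball_subset_closedBall.trans hrU)).diffContOnCl
      (fun z hz => hf1 z (frontier_ball_subset_sphere hz))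
      (subset_closure (closedBall_subset_ball hsr hz))
  have hχ₁ {z : ℂ} (hz : z ∈ closedBall 0 s) : ‖χ₁ z‖ ≤ 1 :=
    hmax hd (fun z hz => (hsphere z hz).trans_le (hχ1 z hz)) hz
  have hψχ₁ {z : ℂ} (hz : z ∈ closedBall 0 s) : ‖ψ z * χ₁ z‖ ≤ 1 :=
    hmax (hψ.mul hd) (fun z hz => by
      simpa only [Pi.mul_apply, norm_mul, hsphere z hz] using hψχ z hz) hz
  have hsU : closedBall 0 s ⊆ U := (closedBall_subset_closedBall hsr.le).trans hrU
  have hharm : InnerProductSpace.HarmonicOnNhd (fun z => -Real.log ‖χ₁ z‖) (closedBall 0 s) :=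
    fun z hz => ((hd.analyticAt (hU.mem_nhds (hsU hz))).harmonicAt_log_norm (hne z hz)).neg
  have hH := (harnack hharm (fun z hz => neg_nonneg.2 <| Real.log_nonpos (norm_nonneg _)
    (hχ₁ (sphere_subset_closedBall hz))) ha).2
  have has : a ∈ closedBall 0 s := by simpa using ha.le
  have hlog : Real.log ‖ψ a‖ ≤ -Real.log ‖χ₁ a‖ := by
    rcases eq_or_ne (ψ a) 0 with h | h
    · simpa [h] using Real.log_nonpos (norm_nonneg _) (hχ₁ has)
    · have := Real.log_nonpos (norm_nonneg _) (hψχ₁ has)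
      rw [norm_mul, Real.log_mul (norm_ne_zero_iff.2 h) (norm_ne_zero_iff.2 (hne a has))] at this
      linarith
  calc (s - ‖a‖) * Real.log ‖ψ a‖ ≤ (s - ‖a‖) * -Real.log ‖χ₁ a‖ := by gcongr
    _ ≤ (s + ‖a‖) * -Real.log ‖χ₁ 0‖ := hH
    _ ≤ (s + ‖a‖) * -Real.log ‖χ 0‖ := by gcongr

theorem le_of_forall_radius_lt_one {f g : ℝ → ℝ} {ρ : ℝ} (hρ : ρ < 1) (hf : Continuous f)
    (hg : Continuous g) (h : ∀ r ∈ Set.Ioo ρ 1, f r ≤ g r) : f 1 ≤ g 1 :=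
  le_on_closure h hf.continuousOn hg.continuousOn
    (by rw [closure_Ioo hρ.ne]; exact Set.right_mem_Icc.2 hρ.le)

/-- Dividing the zeros out of `χ` reduces this to Harnack's inequality for `-log ‖χ‖`. -/
theorem one_sub_mul_log_norm_le_of_mul_le_one {ψ χ : ℂ → ℂ}
    (hψ : DifferentiableOn ℂ ψ (ball 0 1)) (hχ : DifferentiableOn ℂ χ (ball 0 1))
    (hχ1 : ∀ z ∈ ball (0 : ℂ) 1, ‖χ z‖ ≤ 1) (hψχ : ∀ z ∈ ball (0 : ℂ) 1, ‖ψ z * χ z‖ ≤ 1)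
    (h0 : χ 0 ≠ 0) {a : ℂ} (ha : ‖a‖ < 1) :
    (1 - ‖a‖) * Real.log ‖ψ a‖ ≤ (1 + ‖a‖) * -Real.log ‖χ 0‖ := by
  refine le_of_forall_radius_lt_one (f := fun s => (s - ‖a‖) * Real.log ‖ψ a‖)
    (g := fun s => (s + ‖a‖) * -Real.log ‖χ 0‖) ha (by fun_prop) (by fun_prop) fun s hs => ?_
  obtain ⟨r, hsr, hr⟩ := exists_between hs.2
  have hsub : closedBall (0 : ℂ) r ⊆ ball 0 1 := closedBall_subset_ball hr
  exact sub_mul_log_norm_le_of_mul_le_one isOpen_ball hsub hψ hχ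
    (fun z hz => hχ1 z (hsub (sphere_subset_closedBall hz)))
    (fun z hz => hψχ z (hsub (sphere_subset_closedBall hz))) h0 hsr hs.1

theorem one_sub_mul_re_le_of_re_nonneg {f : ℂ → ℂ} (hf : DifferentiableOn ℂ f (ball 0 1))
    (hre : ∀ z ∈ ball (0 : ℂ) 1, 0 ≤ (f z).re) {a : ℂ} (ha : ‖a‖ < 1) :
    (1 - ‖a‖) * (f 0).re ≤ (1 + ‖a‖) * (f a).re := by
  refine le_of_forall_radius_lt_one (f := fun s => (s - ‖a‖) * (f 0).re)
    (g := fun s => (s + ‖a‖) * (f a).re) ha (by fun_prop) (by fun_prop) fun r hr => ?_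
  have hsub : closedBall (0 : ℂ) r ⊆ ball 0 1 := closedBall_subset_ball hr.2
  exact (harnack (u := fun z => (f z).re)
    (fun z hz => (hf.analyticAt (isOpen_ball.mem_nhds (hsub hz))).harmonicAt_re)
    (fun z hz => hre z (hsub (sphere_subset_closedBall hz))) hr.1).1

end Disc

section HalfPlane

open Metric

theorem isOpen_upperHalf : IsOpen upperHalf := isOpen_lt continuous_const Complex.continuous_im

/-- The conformal map of the upper half-plane onto the unit disc that sends `z₀` to `0`. -/
noncomputable def cayley (z₀ z : ℂ) : ℂ := (z - z₀) / (z - conj z₀)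

/-- The inverse of `cayley z₀` on the unit disc. -/
noncomputable def cayleyInv (z₀ ζ : ℂ) : ℂ := (z₀ - ζ * conj z₀) / (1 - ζ)

variable {z₀ z ζ : ℂ}

theorem one_sub_ne_zero_of_norm_lt_one (hζ : ‖ζ‖ < 1) : 1 - ζ ≠ 0 := by
  rintro h
  simp [← sub_eq_zero.1 h] at hζ

@[simp]
theorem cayleyInv_zero (z₀ : ℂ) : cayleyInv z₀ 0 = z₀ := by simp [cayleyInv]

theorem cayleyInv_mem_upperHalf (h₀ : 0 < z₀.im) (hζ : ‖ζ‖ < 1) : cayleyInv z₀ ζ ∈ upperHalf := by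
  have him : (cayleyInv z₀ ζ).im = z₀.im * (1 - ‖ζ‖ ^ 2) / Complex.normSq (1 - ζ) := by
    rw [cayleyInv, Complex.div_im, div_sub_div_same, Complex.sq_norm]
    congr 1
    simp only [Complex.normSq_apply, Complex.sub_re, Complex.sub_im, Complex.mul_re, Complex.mul_im,
      Complex.conj_re, Complex.conj_im, Complex.one_re, Complex.one_im]
    ring
  change 0 < (cayleyInv z₀ ζ).im
  have : 0 < 1 - ‖ζ‖ ^ 2 := by nlinarith [norm_nonneg ζ]
  have := Complex.normSq_pos.2 (one_sub_ne_zero_of_norm_lt_one hζ)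
  rw [him]
  positivity

theorem mapsTo_cayleyInv (h₀ : 0 < z₀.im) : Set.MapsTo (cayleyInv z₀) (ball 0 1) upperHalf :=
  fun _ hζ => cayleyInv_mem_upperHalf h₀ (by simpa using hζ)

theorem differentiableOn_cayleyInv (z₀ : ℂ) : DifferentiableOn ℂ (cayleyInv z₀) (ball 0 1) :=
  DifferentiableOn.div (by fun_prop) (by fun_prop) fun _ hζ =>
    one_sub_ne_zero_of_norm_lt_one (by simpa using hζ)

theorem sub_conj_ne_zero (h₀ : 0 < z₀.im) (hz : 0 ≤ z.im) : z - conj z₀ ≠ 0 := by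
  intro h
  have := congrArg Complex.im h
  simp only [Complex.sub_im, Complex.conj_im, Complex.zero_im] at this
  linarith

theorem cayleyInv_cayley (h₀ : 0 < z₀.im) (hz : 0 < z.im) : cayleyInv z₀ (cayley z₀ z) = z := by
  have h1 := sub_conj_ne_zero h₀ hz.le
  have h2 := sub_conj_ne_zero h₀ h₀.le
  have hnum : z₀ - (z - z₀) / (z - conj z₀) * conj z₀ = z * (z₀ - conj z₀) / (z - conj z₀) := by
    field_simp; ring
  have hden : 1 - (z - z₀) / (z - conj z₀) = (z₀ - conj z₀) / (z - conj z₀) := by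
    field_simp; ring
  rw [cayley, cayleyInv, hnum, hden, div_div_div_cancel_right₀ h1, mul_div_assoc, div_self h2,
    mul_one]

theorem one_sub_norm_cayley_sq (h₀ : 0 < z₀.im) (hz : 0 < z.im) :
    1 - ‖cayley z₀ z‖ ^ 2 = 4 * z.im * z₀.im / ‖z - conj z₀‖ ^ 2 := by
  have h1 := sub_conj_ne_zero h₀ hz.le
  have h2 : 0 < ‖z - conj z₀‖ ^ 2 := by positivity
  rw [cayley, norm_div, div_pow, eq_div_iff h2.ne', sub_mul, div_mul_cancel₀ _ h2.ne']
  simp only [Complex.sq_norm, Complex.normSq_apply, Complex.sub_re, Complex.sub_im,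
    Complex.conj_re, Complex.conj_im]
  ring

theorem norm_cayley_lt_one (h₀ : 0 < z₀.im) (hz : 0 < z.im) : ‖cayley z₀ z‖ < 1 := by
  have h := one_sub_norm_cayley_sq h₀ hz
  have h1 := sub_conj_ne_zero h₀ hz.le
  have : 0 < 4 * z.im * z₀.im / ‖z - conj z₀‖ ^ 2 := by positivity
  nlinarith [norm_nonneg (cayley z₀ z)]

theorem le_one_sub_norm_cayley (h₀ : 0 < z₀.im) (hz : 0 < z.im) :
    z₀.im / (1 + ‖z₀‖ ^ 2) * (z.im / (1 + ‖z‖ ^ 2)) ≤ 1 - ‖cayley z₀ z‖ := by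
  have hdist : ‖z - conj z₀‖ ^ 2 ≤ 2 * ((1 + ‖z₀‖ ^ 2) * (1 + ‖z‖ ^ 2)) := by
    have h := norm_sub_le z (conj z₀)
    rw [Complex.norm_conj] at h
    nlinarith [norm_nonneg z, norm_nonneg z₀, norm_nonneg (z - conj z₀), sq_nonneg (‖z‖ - ‖z₀‖),
      mul_nonneg (sq_nonneg ‖z‖) (sq_nonneg ‖z₀‖)]
  have hpos : 0 < ‖z - conj z₀‖ ^ 2 := by have := sub_conj_ne_zero h₀ hz.le; positivity
  have hsq : 2 * (z₀.im * z.im / ((1 + ‖z₀‖ ^ 2) * (1 + ‖z‖ ^ 2))) ≤ 1 - ‖cayley z₀ z‖ ^ 2 := by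
    rw [one_sub_norm_cayley_sq h₀ hz, mul_div_assoc', div_le_div_iff₀ (by positivity) hpos]
    nlinarith [mul_pos hz h₀]
  rw [div_mul_div_comm]
  nlinarith [norm_nonneg (cayley z₀ z), norm_cayley_lt_one h₀ hz]

theorem exists_norm_le_exp_of_mul_bounded {H q : ℂ → ℂ} (hH : DifferentiableOn ℂ H upperHalf)
    (hq : DifferentiableOn ℂ q upperHalf) {M₁ M₂ : ℝ} (hqM : ∀ z ∈ upperHalf, ‖q z‖ ≤ M₁)
    (hHq : ∀ z ∈ upperHalf, ‖H z * q z‖ ≤ M₂) (h0 : ∃ z ∈ upperHalf, q z ≠ 0) :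
    ∃ C : ℝ, 0 ≤ C ∧ ∀ z ∈ upperHalf, ‖H z‖ ≤ Real.exp (C * ((1 + ‖z‖ ^ 2) / z.im)) := by
  obtain ⟨z₀, h₀, hq0⟩ := h0
  change 0 < z₀.im at h₀
  set M := max (max M₁ M₂) 1
  have hM : 0 < M := zero_lt_one.trans_le (le_max_right _ _)
  have hMn : ‖(M : ℂ)‖ = M := by simp [abs_of_pos hM]
  have hmaps := mapsTo_cayleyInv h₀
  have hcayley := differentiableOn_cayleyInv z₀
  set χ : ℂ → ℂ := fun ζ => q (cayleyInv z₀ ζ) / M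
  have hχ1 : ∀ ζ ∈ ball (0 : ℂ) 1, ‖χ ζ‖ ≤ 1 := fun ζ hζ => by
    rw [norm_div, hMn, div_le_one hM]
    exact (hqM _ (hmaps hζ)).trans ((le_max_left _ _).trans (le_max_left _ _))
  have hψχ : ∀ ζ ∈ ball (0 : ℂ) 1, ‖H (cayleyInv z₀ ζ) * χ ζ‖ ≤ 1 := fun ζ hζ => by
    rw [← mul_div_assoc, norm_div, hMn, div_le_one hM]
    exact (hHq _ (hmaps hζ)).trans ((le_max_right _ _).trans (le_max_left _ _))
  set L := -Real.log ‖χ 0‖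
  have hL : 0 ≤ L := neg_nonneg.2 (Real.log_nonpos (norm_nonneg _) (hχ1 0 (by simp)))
  refine ⟨2 * L / (z₀.im / (1 + ‖z₀‖ ^ 2)), by positivity, fun z (hz : 0 < z.im) => ?_⟩
  have ha := norm_cayley_lt_one h₀ hz
  have hlog : (1 - ‖cayley z₀ z‖) * Real.log ‖H z‖ ≤ (1 + ‖cayley z₀ z‖) * L := by
    have h := one_sub_mul_log_norm_le_of_mul_le_one (hH.comp hcayley hmaps)
      ((hq.comp hcayley hmaps).div_const (M : ℂ)) hχ1 hψχ (by simp [hq0, hM.ne']) ha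
    rw [Function.comp_apply, cayleyInv_cayley h₀ hz] at h
    exact h
  have hdist := le_one_sub_norm_cayley h₀ hz
  refine (Real.le_exp_log _).trans (Real.exp_le_exp.2 ?_)
  calc Real.log ‖H z‖ ≤ 2 * L / (1 - ‖cayley z₀ z‖) := by
        rw [le_div_iff₀ (sub_pos.2 ha)]; nlinarith
    _ ≤ 2 * L / (z₀.im / (1 + ‖z₀‖ ^ 2) * (z.im / (1 + ‖z‖ ^ 2))) := by gcongr
    _ = 2 * L / (z₀.im / (1 + ‖z₀‖ ^ 2)) * ((1 + ‖z‖ ^ 2) / z.im) := by field_simp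

theorem exists_le_re_of_re_nonneg {f : ℂ → ℂ} (hf : DifferentiableOn ℂ f upperHalf)
    (hre : ∀ z ∈ upperHalf, 0 ≤ (f z).re) (hz₀ : ∃ z ∈ upperHalf, 0 < (f z).re) :
    ∃ c : ℝ, 0 < c ∧ ∀ z ∈ upperHalf, c * (z.im / (1 + ‖z‖ ^ 2)) ≤ (f z).re := by
  obtain ⟨z₀, h₀, hfz₀⟩ := hz₀
  change 0 < z₀.im at h₀
  refine ⟨z₀.im / (1 + ‖z₀‖ ^ 2) * (f z₀).re / 2, by positivity, fun z (hz : 0 < z.im) => ?_⟩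
  have ha := norm_cayley_lt_one h₀ hz
  have hharnack := one_sub_mul_re_le_of_re_nonneg
    (hf.comp (differentiableOn_cayleyInv z₀) (mapsTo_cayleyInv h₀))
    (fun ζ hζ => hre _ (mapsTo_cayleyInv h₀ hζ)) ha
  simp only [Function.comp_apply, cayleyInv_zero, cayleyInv_cayley h₀ hz] at hharnack
  have hdist := mul_le_mul_of_nonneg_right (le_one_sub_norm_cayley h₀ hz) hfz₀.le
  nlinarith [hre z hz]

/-- The boundary barrier of the half-disc `‖z‖ < R`, `0 < Im z`: its real part is nonnegative
there and equals `1 / Im z` on the arc `‖z‖ = R`. -/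
noncomputable def arcBarrier (R : ℝ) (z : ℂ) : ℂ :=
  Complex.I / (z - (R : ℝ)) + Complex.I / (z - (-R : ℝ))

theorem re_I_div_sub_ofReal (z : ℂ) (r : ℝ) :
    (Complex.I / (z - r)).re = z.im / ‖z - r‖ ^ 2 := by
  rw [Complex.div_re, Complex.sq_norm]
  simp

theorem re_arcBarrier (R : ℝ) (z : ℂ) :
    (arcBarrier R z).re = z.im / ‖z - (R : ℝ)‖ ^ 2 + z.im / ‖z - (-R : ℝ)‖ ^ 2 := by
  simp only [arcBarrier, Complex.add_re, re_I_div_sub_ofReal]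

theorem re_arcBarrier_nonneg (R : ℝ) (hz : 0 ≤ z.im) : 0 ≤ (arcBarrier R z).re := by
  rw [re_arcBarrier]; positivity

theorem re_arcBarrier_of_norm_eq {R : ℝ} (hz : 0 < z.im) (hR : ‖z‖ = R) :
    (arcBarrier R z).re = 1 / z.im := by
  have hsq : z.re ^ 2 + z.im ^ 2 = R ^ 2 := by
    rw [← hR, Complex.sq_norm, Complex.normSq_apply]; ring
  have hneg : ‖z - (R : ℝ)‖ ^ 2 = 2 * R * (R - z.re) := by
    rw [Complex.sq_norm, Complex.normSq_apply]
    simp only [Complex.sub_re, Complex.ofReal_re, Complex.sub_im, Complex.ofReal_im]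
    linarith
  have hpos : ‖z - (-R : ℝ)‖ ^ 2 = 2 * R * (R + z.re) := by
    rw [Complex.sq_norm, Complex.normSq_apply]
    simp only [Complex.sub_re, Complex.ofReal_re, Complex.sub_im, Complex.ofReal_im]
    linarith
  have hR0 : 0 < R := hR ▸ hz.trans_le ((le_abs_self _).trans (Complex.abs_im_le_norm z))
  have hsub : R - z.re ≠ 0 := fun h => by nlinarith
  have hadd : R + z.re ≠ 0 := fun h => by nlinarith
  rw [re_arcBarrier, hneg, hpos]
  field_simp
  linear_combination (2 * R) * hsq

theorem re_arcBarrier_le {R : ℝ} (hz : 0 ≤ z.im) (hR : ‖z‖ < R) :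
    (arcBarrier R z).re ≤ 2 * (z.im / (R - ‖z‖) ^ 2) := by
  have hR0 : 0 < R := (norm_nonneg z).trans_lt hR
  have : 0 < R - ‖z‖ := sub_pos.2 hR
  have hle (r : ℝ) (hr : |r| = R) : z.im / ‖z - (r : ℝ)‖ ^ 2 ≤ z.im / (R - ‖z‖) ^ 2 := by
    have h := norm_sub_norm_le (r : ℂ) z
    rw [norm_sub_rev, Complex.norm_real, Real.norm_eq_abs, hr] at h
    gcongr
  rw [re_arcBarrier, two_mul]
  exact add_le_add (hle R (abs_of_pos hR0)) (hle (-R) (by rw [abs_neg, abs_of_pos hR0]))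

theorem differentiableAt_arcBarrier (R : ℝ) (hz : 0 < z.im) :
    DifferentiableAt ℂ (arcBarrier R) z := by
  have hne (r : ℝ) : z - (r : ℂ) ≠ 0 := fun h => by
    have := congrArg Complex.im h
    simp only [Complex.sub_im, Complex.ofReal_im, Complex.zero_im] at this
    linarith
  have hdiv (r : ℝ) : DifferentiableAt ℂ (fun u : ℂ => Complex.I / (u - (r : ℂ))) z :=
    (differentiableAt_const _).div (differentiableAt_id.sub_const _) (hne r)
  exact (hdiv R).add (hdiv (-R))

theorem frontier_ball_inter_upperHalf {R : ℝ} (hz : z ∈ frontier (ball 0 R ∩ upperHalf)) :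
    z.im = 0 ∨ 0 < z.im ∧ ‖z‖ = R := by
  rw [frontier, (isOpen_ball.inter isOpen_upperHalf).interior_eq] at hz
  have hR : ‖z‖ ≤ R := by
    simpa using closure_ball_subset_closedBall (closure_mono Set.inter_subset_left hz.1)
  have him : 0 ≤ z.im := by
    have := closure_mono Set.inter_subset_right hz.1
    rwa [upperHalf, Complex.closure_setOfPred_lt_im] at this
  refine him.eq_or_lt.imp Eq.symm fun hpos => ⟨hpos, hR.antisymm (not_lt.1 fun hlt => ?_)⟩
  exact hz.2 ⟨by simpa using hlt, hpos⟩

variable {H : ℂ → ℂ}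

theorem norm_le_exp_re_arcBarrier (hH : DifferentiableOn ℂ H upperHalf) {C : ℝ} (hC : 0 ≤ C)
    (hgrowth : ∀ z ∈ upperHalf, ‖H z‖ ≤ Real.exp (C * ((1 + ‖z‖ ^ 2) / z.im)))
    (hbd : ∀ x : ℝ, ∀ᶠ z in 𝓝[upperHalf] (x : ℂ), ‖H z‖ ≤ 1) (hz : z ∈ upperHalf) {R : ℝ}
    (hR : ‖z‖ < R) : ‖H z‖ ≤ Real.exp (C * (1 + R ^ 2) * (arcBarrier R z).re) := by
  set K := C * (1 + R ^ 2)
  have hK : 0 ≤ K := by positivity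
  set f : ℂ → ℂ := fun u => H u * Complex.exp (-(K * arcBarrier R u))
  have hfn (u : ℂ) : ‖f u‖ = ‖H u‖ * Real.exp (-(K * (arcBarrier R u).re)) := by
    simp only [f, norm_mul, Complex.norm_exp, Complex.neg_re, Complex.re_ofReal_mul]
  have hfd : ∀ u ∈ upperHalf, DifferentiableAt ℂ f u := fun u hu =>
    (hH.differentiableAt (isOpen_upperHalf.mem_nhds hu)).mul
      ((differentiableAt_arcBarrier R hu).const_mul _).neg.cexp
  have harc {ζ : ℂ} (hζ : 0 < ζ.im) (hζR : ‖ζ‖ = R) : ‖f ζ‖ ≤ 1 := by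
    rw [hfn, re_arcBarrier_of_norm_eq hζ hζR, Real.exp_neg, ← div_eq_mul_inv,
      div_le_one (Real.exp_pos _)]
    refine (hgrowth ζ hζ).trans_eq (congrArg Real.exp ?_)
    rw [hζR, mul_assoc, mul_one_div]
  have hfz : ‖f z‖ ≤ 1 := le_of_forall_pos_le_add fun η hη => by
    refine norm_le_of_eventually_frontier (isOpen_ball.inter isOpen_upperHalf)
      (isBounded_ball.subset Set.inter_subset_left)
      (fun u hu => (hfd u hu.2).differentiableWithinAt) (fun ζ hζ => ?_)
      (⟨by simpa using hR, hz⟩ : z ∈ ball 0 R ∩ upperHalf)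
    rcases frontier_ball_inter_upperHalf hζ with hreal | ⟨hpos, hζR⟩
    · obtain ⟨x, rfl⟩ : ∃ x : ℝ, (x : ℂ) = ζ := ⟨ζ.re, Complex.ext rfl hreal.symm⟩
      filter_upwards [nhdsWithin_mono _ Set.inter_subset_right (hbd x), self_mem_nhdsWithin]
        with u hu huD
      have hexp : Real.exp (-(K * (arcBarrier R u).re)) ≤ 1 := Real.exp_le_one_iff.2
        (neg_nonpos.2 (mul_nonneg hK (re_arcBarrier_nonneg R (le_of_lt huD.2))))
      rw [hfn]
      exact (mul_le_one₀ hu (Real.exp_pos _).le hexp).trans (by linarith)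
    · have hlt : ‖f ζ‖ < 1 + η := (harc hpos hζR).trans_lt (by linarith)
      exact nhdsWithin_le_nhds (((hfd ζ hpos).continuousAt.norm.eventually_lt_const hlt).mono
        fun u hu => hu.le)
  rwa [hfn, Real.exp_neg, ← div_eq_mul_inv, div_le_one (Real.exp_pos _)] at hfz

theorem norm_le_exp_im_of_boundary (hH : DifferentiableOn ℂ H upperHalf) {C : ℝ} (hC : 0 ≤ C)
    (hgrowth : ∀ z ∈ upperHalf, ‖H z‖ ≤ Real.exp (C * ((1 + ‖z‖ ^ 2) / z.im)))
    (hbd : ∀ x : ℝ, ∀ᶠ z in 𝓝[upperHalf] (x : ℂ), ‖H z‖ ≤ 1) (hz : z ∈ upperHalf) :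
    ‖H z‖ ≤ Real.exp (2 * C * z.im) := by
  have hlim : Tendsto (fun R : ℝ => Real.exp (2 * C * z.im * ((1 + R ^ 2) / (R - ‖z‖) ^ 2))) atTop
      (𝓝 (Real.exp (2 * C * z.im * 1))) := by
    refine (Real.continuous_exp.tendsto _).comp (Tendsto.const_mul _ ?_)
    have hratio : Tendsto (fun R : ℝ => (R⁻¹ ^ 2 + 1) / (1 - ‖z‖ * R⁻¹) ^ 2) atTop
        (𝓝 ((0 ^ 2 + 1) / (1 - ‖z‖ * 0) ^ 2)) :=
      ((tendsto_inv_atTop_zero.pow 2).add_const 1).div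
        (((tendsto_inv_atTop_zero.const_mul ‖z‖).const_sub 1).pow 2) (by simp)
    rw [show ((0 : ℝ) ^ 2 + 1) / (1 - ‖z‖ * 0) ^ 2 = 1 by norm_num] at hratio
    refine hratio.congr' ?_
    filter_upwards [eventually_gt_atTop ‖z‖] with R hR
    have hR0 : R ≠ 0 := ((norm_nonneg z).trans_lt hR).ne'
    have hRz : R - ‖z‖ ≠ 0 := (sub_pos.2 hR).ne'
    field_simp
  rw [mul_one] at hlim
  refine ge_of_tendsto hlim ?_
  filter_upwards [eventually_gt_atTop ‖z‖] with R hR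
  refine (norm_le_exp_re_arcBarrier hH hC hgrowth hbd hz hR).trans (Real.exp_le_exp.2 ?_)
  refine (mul_le_mul_of_nonneg_left (re_arcBarrier_le (le_of_lt hz) hR) (by positivity)).trans_eq ?_
  ring

theorem norm_le_mul_exp_re {g : ℂ → ℂ} {B M s : ℝ} (hg : DiffContOnCl ℂ g {w | 0 < w.re})
    (hs : 0 ≤ s) (hgrowth : ∀ w : ℂ, 0 ≤ w.re → ‖g w‖ ≤ M * Real.exp (B * w.re)) (hB : 0 ≤ B)
    (hray : ∃ K : ℝ, ∀ᶠ x : ℝ in atTop, ‖g x‖ ≤ K * Real.exp (s * x)) {w : ℂ} (hw : 0 ≤ w.re) :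
    ‖g w‖ ≤ M * Real.exp (s * w.re) := by
  have hM : 0 ≤ M := by simpa using (norm_nonneg _).trans (hgrowth 0 le_rfl)
  set f : ℂ → ℂ := fun w => g w * Complex.exp (-(s * w))
  have hfn (w : ℂ) : ‖f w‖ = ‖g w‖ / Real.exp (s * w.re) := by
    simp only [f, norm_mul, Complex.norm_exp, Complex.neg_re, Complex.re_ofReal_mul, Real.exp_neg,
      div_eq_mul_inv]
  have hf : DiffContOnCl ℂ f {w | 0 < w.re} :=
    hg.smul (by fun_prop : Differentiable ℂ fun w : ℂ => Complex.exp (-(s * w))).diffContOnCl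
  have hexp : ∃ c < (2 : ℝ), ∃ B' : ℝ, f =O[Bornology.cobounded ℂ ⊓ 𝓟 {w | 0 < w.re}]
      fun w => Real.exp (B' * ‖w‖ ^ c) := by
    refine ⟨1, by norm_num, B, .of_bound M ?_⟩
    refine eventually_inf_principal.2 (Eventually.of_forall fun w (hw : 0 < w.re) => ?_)
    rw [hfn, Real.rpow_one, Real.norm_eq_abs, Real.abs_exp]
    refine (div_le_self (norm_nonneg _) (Real.one_le_exp (by positivity))).trans
      ((hgrowth w hw.le).trans ?_)
    gcongr
    exact Complex.re_le_norm w
  have hray' : IsBoundedUnder (· ≤ ·) atTop fun x : ℝ => ‖f x‖ := by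
    obtain ⟨K, hK⟩ := hray
    refine ⟨K, eventually_map.2 (hK.mono fun x hx => ?_)⟩
    change ‖f x‖ ≤ K
    rwa [hfn, Complex.ofReal_re, div_le_iff₀ (Real.exp_pos _)]
  have hline (x : ℝ) : ‖f (x * Complex.I)‖ ≤ M := by
    simpa [hfn] using hgrowth (x * Complex.I) (by simp)
  have hPL := PhragmenLindelof.right_half_plane_of_bounded_on_real hf hexp hray' hline hw
  rwa [hfn, div_le_iff₀ (Real.exp_pos _)] at hPL

theorem norm_le_exp_of_lt_im (hH : DifferentiableOn ℂ H upperHalf) {B : ℝ} (hB : 0 ≤ B)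
    (hgrowth : ∀ z ∈ upperHalf, ‖H z‖ ≤ Real.exp (B * z.im))
    (hmt : ∀ ε > 0, ∀ᶠ y : ℝ in atTop, ‖H (Complex.I * y)‖ ≤ Real.exp (ε * y)) {s : ℝ}
    (hs : 0 < s) (hsz : s < z.im) :
    ‖H z‖ ≤ Real.exp (B * s) * Real.exp (s * (z.im - s)) := by
  have him (w : ℂ) : (Complex.I * (w + s)).im = w.re + s := by simp
  have hmem (w : ℂ) (hw : 0 ≤ w.re) : Complex.I * (w + s) ∈ upperHalf := by
    change 0 < (Complex.I * (w + s)).im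
    rw [him]; linarith
  have hd : DiffContOnCl ℂ (fun w => H (Complex.I * (w + s))) {w | 0 < w.re} := by
    refine DifferentiableOn.diffContOnCl (hH.comp (by fun_prop) fun w hw => hmem w ?_)
    rwa [Complex.closure_setOfPred_lt_re] at hw
  have h := norm_le_mul_exp_re (M := Real.exp (B * s)) hd hs.le (fun w hw => ?_) hB
    ⟨Real.exp (s * s), ?_⟩ (w := -Complex.I * z - s) (by simpa using hsz.le)
  · have hpt : -(Complex.I * (Complex.I * z)) = z := by
      rw [← mul_assoc, Complex.I_mul_I, neg_one_mul, neg_neg]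
    simpa [hpt] using h
  · rw [← Real.exp_add, ← mul_add, add_comm s, ← him]
    exact hgrowth _ (hmem w hw)
  · filter_upwards [(tendsto_atTop_add_const_right atTop s tendsto_id).eventually (hmt s hs)]
      with x hx
    rw [← Real.exp_add, ← mul_add, add_comm s]
    simpa using hx

theorem norm_le_one_of_exp_im (hH : DifferentiableOn ℂ H upperHalf) {B : ℝ} (hB : 0 ≤ B)
    (hgrowth : ∀ z ∈ upperHalf, ‖H z‖ ≤ Real.exp (B * z.im))
    (hmt : ∀ ε > 0, ∀ᶠ y : ℝ in atTop, ‖H (Complex.I * y)‖ ≤ Real.exp (ε * y))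
    (hz : z ∈ upperHalf) : ‖H z‖ ≤ 1 := by
  have hlim : Tendsto (fun s : ℝ => Real.exp (B * s) * Real.exp (s * (z.im - s))) (𝓝[>] 0)
      (𝓝 1) := by
    have hc : Continuous fun s : ℝ => Real.exp (B * s) * Real.exp (s * (z.im - s)) := by fun_prop
    simpa using (hc.tendsto 0).mono_left nhdsWithin_le_nhds
  refine ge_of_tendsto hlim ?_
  filter_upwards [self_mem_nhdsWithin, nhdsWithin_le_nhds (gt_mem_nhds hz)] with s hs hsz
  exact norm_le_exp_of_lt_im hH hB hgrowth hmt hs hsz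

/-- Phragmén–Lindelöf in two steps: the growth condition and the boundary condition give a bound
`exp (2 C Im z)`, which the mean type along the imaginary axis improves to `1`. -/
theorem norm_le_one_of_boundary (hH : DifferentiableOn ℂ H upperHalf) {C : ℝ} (hC : 0 ≤ C)
    (hgrowth : ∀ z ∈ upperHalf, ‖H z‖ ≤ Real.exp (C * ((1 + ‖z‖ ^ 2) / z.im)))
    (hbd : ∀ x : ℝ, ∀ᶠ z in 𝓝[upperHalf] (x : ℂ), ‖H z‖ ≤ 1)
    (hmt : ∀ ε > 0, ∀ᶠ y : ℝ in atTop, ‖H (Complex.I * y)‖ ≤ Real.exp (ε * y))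
    (hz : z ∈ upperHalf) : ‖H z‖ ≤ 1 :=
  norm_le_one_of_exp_im hH (by positivity)
    (fun _ hu => norm_le_exp_im_of_boundary hH hC hgrowth hbd hu) hmt hz

end HalfPlane

section Hardy

variable {m : ℝ → ℝ} {h : ℂ → ℂ} {z : ℂ}

theorem I_mul_ofReal_mem_upperHalf {y : ℝ} (hy : 0 < y) : Complex.I * y ∈ upperHalf := by
  simpa [upperHalf] using hy

theorem im_le_norm_sub_ofReal (z : ℂ) (t : ℝ) : z.im ≤ ‖z - t‖ := by
  simpa using (le_abs_self _).trans (Complex.abs_im_le_norm (z - t))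

theorem sub_ofReal_ne_zero (hz : 0 < z.im) (t : ℝ) : z - (t : ℂ) ≠ 0 :=
  norm_pos_iff.1 (hz.trans_le (im_le_norm_sub_ofReal z t))

/-- The analytic function in the upper half-plane whose real part is `π` times the Poisson integral
of `m`. -/
noncomputable def schwarzIntegral (m : ℝ → ℝ) (z : ℂ) : ℂ :=
  ∫ t : ℝ, (m t : ℂ) * (Complex.I / (z - t))

theorem norm_schwarz_integrand_le (hm0 : ∀ t, 0 ≤ m t) (hz : 0 < z.im) (t : ℝ) :
    ‖(m t : ℂ) * (Complex.I / (z - t))‖ ≤ m t * (1 / z.im) := by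
  rw [norm_mul, norm_div, Complex.norm_I, Complex.norm_of_nonneg (hm0 t)]
  have := hm0 t
  gcongr
  exact im_le_norm_sub_ofReal z t

theorem continuous_schwarz_integrand (hmc : Continuous m) (hz : 0 < z.im) :
    Continuous fun t : ℝ => (m t : ℂ) * (Complex.I / (z - t)) :=
  (Complex.continuous_ofReal.comp hmc).mul
    (continuous_const.div (by fun_prop) fun t => sub_ofReal_ne_zero hz t)

theorem integrable_schwarz_integrand (hmc : Continuous m) (hm0 : ∀ t, 0 ≤ m t)
    (hmi : Integrable m) (hz : 0 < z.im) :
    Integrable fun t : ℝ => (m t : ℂ) * (Complex.I / (z - t)) :=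
  (hmi.mul_const (1 / z.im)).mono' (continuous_schwarz_integrand hmc hz).aestronglyMeasurable
    (Eventually.of_forall fun t => norm_schwarz_integrand_le hm0 hz t)

theorem norm_schwarzIntegral_le (hm0 : ∀ t, 0 ≤ m t) (hmi : Integrable m) (hz : 0 < z.im) :
    ‖schwarzIntegral m z‖ ≤ (∫ t, m t) / z.im := by
  rw [div_eq_mul_one_div, ← integral_mul_const]
  exact norm_integral_le_of_norm_le (hmi.mul_const _)
    (Eventually.of_forall fun t => norm_schwarz_integrand_le hm0 hz t)

theorem half_im_lt_im {z₀ : ℂ} (hz : z ∈ Metric.ball z₀ (z₀.im / 2)) : z₀.im / 2 < z.im := by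
  have him : |(z - z₀).im| < z₀.im / 2 :=
    (Complex.abs_im_le_norm _).trans_lt (mem_ball_iff_norm.1 hz)
  rw [Complex.sub_im, abs_lt] at him
  linarith

theorem differentiableOn_schwarzIntegral (hmc : Continuous m) (hm0 : ∀ t, 0 ≤ m t)
    (hmi : Integrable m) : DifferentiableOn ℂ (schwarzIntegral m) upperHalf := by
  intro z₀ (h0 : 0 < z₀.im)
  have hball : Metric.ball z₀ (z₀.im / 2) ∈ 𝓝 z₀ := Metric.ball_mem_nhds z₀ (half_pos h0)
  have hpos {z : ℂ} (hz : z ∈ Metric.ball z₀ (z₀.im / 2)) : 0 < z.im :=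
    (half_pos h0).trans (half_im_lt_im hz)
  refine (hasDerivAt_integral_of_dominated_loc_of_deriv_le (𝕜 := ℂ) (μ := volume)
    (F' := fun z (t : ℝ) => (m t : ℂ) * (-Complex.I / (z - t) ^ 2))
    (bound := fun t => m t * (1 / (z₀.im / 2) ^ 2)) hball ?_
    (integrable_schwarz_integrand hmc hm0 hmi h0) ?_ ?_ (hmi.mul_const _)
    ?_).2.differentiableAt.differentiableWithinAt
  · filter_upwards [hball] with z hz
    exact (continuous_schwarz_integrand hmc (hpos hz)).aestronglyMeasurable
  · exact ((Complex.continuous_ofReal.comp hmc).mul (continuous_const.div (by fun_prop)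
      fun t => pow_ne_zero 2 (sub_ofReal_ne_zero h0 t))).aestronglyMeasurable
  · refine Eventually.of_forall fun t z hz => ?_
    have hle := (half_im_lt_im hz).le.trans (im_le_norm_sub_ofReal z t)
    have := hm0 t
    rw [norm_mul, norm_div, norm_neg, Complex.norm_I, Complex.norm_of_nonneg (hm0 t), norm_pow]
    gcongr
  · refine Eventually.of_forall fun t z hz => ?_
    simpa [div_eq_mul_inv] using ((((hasDerivAt_id z).sub_const (t : ℂ)).inv
      (sub_ofReal_ne_zero (hpos hz) t)).const_mul Complex.I).const_mul (m t : ℂ)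

theorem re_schwarz_integrand (m : ℝ → ℝ) (z : ℂ) (t : ℝ) :
    ((m t : ℂ) * (Complex.I / (z - t))).re = m t * (z.im / ‖z - t‖ ^ 2) := by
  rw [Complex.re_ofReal_mul, re_I_div_sub_ofReal]

theorem integrable_mul_poisson (hmc : Continuous m) (hm0 : ∀ t, 0 ≤ m t) (hmi : Integrable m)
    (hz : 0 < z.im) : Integrable fun t : ℝ => m t * (z.im / ‖z - t‖ ^ 2) := by
  simpa only [RCLike.re_to_complex, re_schwarz_integrand]
    using (integrable_schwarz_integrand hmc hm0 hmi hz).re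

theorem re_schwarzIntegral (hmc : Continuous m) (hm0 : ∀ t, 0 ≤ m t) (hmi : Integrable m)
    (hz : 0 < z.im) : (schwarzIntegral m z).re = ∫ t : ℝ, m t * (z.im / ‖z - t‖ ^ 2) := by
  simpa only [Complex.reCLM_apply, re_schwarz_integrand, schwarzIntegral] using
    (Complex.reCLM.integral_comp_comm (integrable_schwarz_integrand hmc hm0 hmi hz)).symm

theorem re_schwarzIntegral_nonneg (hmc : Continuous m) (hm0 : ∀ t, 0 ≤ m t) (hmi : Integrable m)
    (hz : 0 < z.im) : 0 ≤ (schwarzIntegral m z).re := by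
  rw [re_schwarzIntegral hmc hm0 hmi hz]
  exact integral_nonneg fun t => mul_nonneg (hm0 t) (div_nonneg hz.le (sq_nonneg _))

theorem one_div_two_mul_im_le (hz : 0 < z.im) {t : ℝ} (ht : |t - z.re| ≤ z.im) :
    1 / (2 * z.im) ≤ z.im / ‖z - t‖ ^ 2 := by
  have hnorm : ‖z - t‖ ^ 2 = (t - z.re) ^ 2 + z.im ^ 2 := by
    rw [Complex.sq_norm, Complex.normSq_apply]
    simp only [Complex.sub_re, Complex.ofReal_re, Complex.sub_im, Complex.ofReal_im, sub_zero]
    ring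
  rw [hnorm, div_le_div_iff₀ (by positivity) (by positivity)]
  linarith [sq_le_sq' (abs_le.1 ht).1 (abs_le.1 ht).2]

theorem le_re_schwarzIntegral (hmc : Continuous m) (hm0 : ∀ t, 0 ≤ m t) (hmi : Integrable m)
    (hz : 0 < z.im) {c : ℝ} (hc : ∀ t, |t - z.re| ≤ z.im → c ≤ m t) :
    c ≤ (schwarzIntegral m z).re := by
  have hi := integrable_mul_poisson hmc hm0 hmi hz
  rw [re_schwarzIntegral hmc hm0 hmi hz]
  calc c = ∫ _ in Set.Icc (z.re - z.im) (z.re + z.im), c * (1 / (2 * z.im)) := by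
        rw [setIntegral_const, Real.volume_real_Icc_of_le (by linarith), smul_eq_mul]
        field_simp
        ring
    _ ≤ ∫ t in Set.Icc (z.re - z.im) (z.re + z.im), m t * (z.im / ‖z - t‖ ^ 2) := by
        refine setIntegral_mono_on continuousOn_const.integrableOn_Icc hi.integrableOn
          measurableSet_Icc fun t ht => ?_
        have habs : |t - z.re| ≤ z.im := abs_le.2 ⟨by linarith [ht.1], by linarith [ht.2]⟩
        exact mul_le_mul (hc t habs) (one_div_two_mul_im_le hz habs) (by positivity) (hm0 t)
    _ ≤ _ := setIntegral_le_integral hi (Eventually.of_forall fun t =>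
        mul_nonneg (hm0 t) (div_nonneg hz.le (sq_nonneg _)))

theorem eventually_sub_le_re_schwarzIntegral (hmc : Continuous m) (hm0 : ∀ t, 0 ≤ m t)
    (hmi : Integrable m) (x : ℝ) {δ : ℝ} (hδ : 0 < δ) :
    ∀ᶠ z in 𝓝[upperHalf] (x : ℂ), m x - δ ≤ (schwarzIntegral m z).re := by
  obtain ⟨r, hr, hball⟩ := Metric.eventually_nhds_iff.1
    ((hmc.tendsto x).eventually (lt_mem_nhds (sub_lt_self (m x) hδ)))
  filter_upwards [nhdsWithin_le_nhds (Metric.ball_mem_nhds (x : ℂ) (half_pos hr)),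
    self_mem_nhdsWithin] with z hz hzU
  refine le_re_schwarzIntegral hmc hm0 hmi hzU fun t ht => (hball ?_).le
  have hre : |z.re - x| < r / 2 := by
    simpa using (Complex.abs_re_le_norm (z - x)).trans_lt (mem_ball_iff_norm.1 hz)
  have him : z.im < r / 2 := (im_le_norm_sub_ofReal z x).trans_lt (mem_ball_iff_norm.1 hz)
  rw [Real.dist_eq]
  linarith [abs_sub_le t z.re x]

theorem meanType_nonpos_iff :
    meanType h ≤ 0 ↔ ∀ ε > 0, ∀ᶠ y : ℝ in atTop, ‖h (Complex.I * y)‖ ≤ Real.exp (ε * y) := by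
  have hlog {ε y : ℝ} (hy : 0 < y) : ENNReal.log ‖h (Complex.I * y)‖ₑ / (y : EReal) ≤ ε ↔
      ‖h (Complex.I * y)‖ ≤ Real.exp (ε * y) := by
    rw [EReal.div_le_iff_le_mul (by exact_mod_cast hy) (EReal.coe_ne_top y), ← EReal.coe_mul,
      mul_comm y ε, ← Real.log_exp (ε * y), ← ENNReal.log_ofReal_of_pos (Real.exp_pos _),
      ENNReal.log_le_log_iff, ← ofReal_norm, ENNReal.ofReal_le_ofReal_iff (Real.exp_pos _).le,
      Real.log_exp]
  refine ⟨fun hmt ε hε => ?_, fun hexp => le_of_forall_gt_imp_ge_of_dense fun a ha => ?_⟩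
  · have hlt : meanType h < (ε : EReal) := hmt.trans_lt (by exact_mod_cast hε)
    filter_upwards [eventually_lt_of_limsup_lt hlt, eventually_gt_atTop 0] with y hy hy0
    exact (hlog hy0).1 hy.le
  · obtain ⟨ε, hε, hεa⟩ := EReal.lt_iff_exists_real_btwn.1 ha
    refine (limsup_le_of_le (by isBoundedDefault) ?_).trans hεa.le
    filter_upwards [hexp ε (by exact_mod_cast hε), eventually_gt_atTop 0] with y hy hy0
    exact (hlog hy0).2 hy

/-- The Hardy space `H²` of the upper half-plane, restricted to functions analytic across the real
line: square integrability on the line and the growth `O((Im z)^(-1/2))` replace the usual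
condition on the integrals over horizontal lines. -/
structure IsHardy (h : ℂ → ℂ) : Prop where
  analyticOnNhd : AnalyticOnNhd ℂ h {z | 0 ≤ z.im}
  integrable : Integrable (fun t : ℝ => ‖h t‖ ^ 2)
  bound : ∃ C : ℝ, ∀ z : ℂ, 0 < z.im → ‖h z‖ ^ 2 * z.im ≤ C

theorem continuous_comp_ofReal (ha : AnalyticOnNhd ℂ h {z | 0 ≤ z.im}) :
    Continuous fun t : ℝ => h t :=
  continuous_iff_continuousAt.2 fun t => ContinuousAt.comp (f := fun t : ℝ => (t : ℂ))
    (ha t (by simp)).continuousAt Complex.continuous_ofReal.continuousAt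

theorem differentiableOn_upperHalf (ha : AnalyticOnNhd ℂ h {z | 0 ≤ z.im}) :
    DifferentiableOn ℂ h upperHalf :=
  fun z (hz : 0 < z.im) => (ha z hz.le).differentiableAt.differentiableWithinAt

theorem eventually_norm_sq_le_add_re_schwarzIntegral (ha : AnalyticOnNhd ℂ h {z | 0 ≤ z.im})
    (hi : Integrable fun t : ℝ => ‖h t‖ ^ 2) (x : ℝ) {ε : ℝ} (hε : 0 < ε) :
    ∀ᶠ z in 𝓝[upperHalf] (x : ℂ),
      ‖h z‖ ^ 2 ≤ ε + (schwarzIntegral (fun t => ‖h t‖ ^ 2) z).re := by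
  have hcont : ContinuousAt (fun z => ‖h z‖ ^ 2) (x : ℂ) :=
    (ha x (by simp)).continuousAt.norm.pow 2
  filter_upwards [nhdsWithin_le_nhds (hcont.eventually
      (gt_mem_nhds (lt_add_of_pos_right _ (half_pos hε)))),
    eventually_sub_le_re_schwarzIntegral (m := fun t => ‖h t‖ ^ 2)
      ((continuous_comp_ofReal ha).norm.pow 2) (fun t => sq_nonneg _) hi x (half_pos hε)]
    with z hz hV
  linarith

theorem one_le_one_add_norm_sq_div_im (hz : z ∈ upperHalf) : 1 ≤ (1 + ‖z‖ ^ 2) / z.im := by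
  have hzim : 0 < z.im := hz
  rw [one_le_div hzim]
  nlinarith [(le_abs_self _).trans (Complex.abs_im_le_norm z), sq_nonneg (‖z‖ - 1)]

theorem eventually_norm_sq_div_le_exp
    (hmt : ∀ ε > 0, ∀ᶠ y : ℝ in atTop, ‖h (Complex.I * y)‖ ≤ Real.exp (ε * y)) {δ ε : ℝ}
    (hδ : 0 < δ) (hε : 0 < ε) :
    ∀ᶠ y : ℝ in atTop, ‖h (Complex.I * y)‖ ^ 2 / δ ≤ Real.exp (ε * y) := by
  have hlim : Tendsto (fun y : ℝ => Real.exp (ε / 2 * y)) atTop atTop :=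
    Real.tendsto_exp_atTop.comp (tendsto_id.const_mul_atTop (half_pos hε))
  filter_upwards [hmt (ε / 4) (by positivity), hlim.eventually_ge_atTop (1 / δ)] with y hy hyδ
  calc ‖h (Complex.I * y)‖ ^ 2 / δ ≤ Real.exp (ε / 4 * y) ^ 2 * Real.exp (ε / 2 * y) := by
        rw [div_eq_mul_one_div]; gcongr
    _ = Real.exp (ε * y) := by rw [← Real.exp_nat_mul, ← Real.exp_add]; push_cast; ring_nf

theorem exists_norm_sq_div_le_exp (hbt : IsBoundedType h) {δ : ℝ} (hδ : 0 < δ) :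
    ∃ C : ℝ, 0 ≤ C ∧
      ∀ z ∈ upperHalf, ‖h z‖ ^ 2 / δ ≤ Real.exp (C * ((1 + ‖z‖ ^ 2) / z.im)) := by
  obtain ⟨hd, p, q, -, hq, ⟨M₁, hM₁⟩, ⟨M₂, hM₂⟩, hq0, hpq⟩ := hbt
  obtain ⟨C, hC, hgrowth⟩ := exists_norm_le_exp_of_mul_bounded hd hq hM₂
    (fun z hz => (hpq z hz).symm ▸ hM₁ z hz) hq0
  refine ⟨2 * C + 1 / δ, by positivity, fun z hz => ?_⟩
  have hexp : 1 / δ ≤ Real.exp (1 / δ * ((1 + ‖z‖ ^ 2) / z.im)) :=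
    (le_mul_of_one_le_right (by positivity) (one_le_one_add_norm_sq_div_im hz)).trans
      ((le_add_of_nonneg_right zero_le_one).trans (Real.add_one_le_exp _))
  calc ‖h z‖ ^ 2 / δ ≤ Real.exp (C * ((1 + ‖z‖ ^ 2) / z.im)) ^ 2 *
        Real.exp (1 / δ * ((1 + ‖z‖ ^ 2) / z.im)) := by
        rw [div_eq_mul_one_div]
        gcongr
        exact hgrowth z hz
    _ = _ := by rw [← Real.exp_nat_mul, ← Real.exp_add]; push_cast; ring_nf

/-- `h² / (ε + V)`, with `Re V` dominating `|h|²` at the boundary, is bounded by `1` by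
Phragmén–Lindelöf. -/
theorem norm_sq_le_add_norm_schwarzIntegral (ha : AnalyticOnNhd ℂ h {z | 0 ≤ z.im})
    (hi : Integrable fun t : ℝ => ‖h t‖ ^ 2) (hbt : IsBoundedType h) (hmt : meanType h ≤ 0)
    (hz : z ∈ upperHalf) {ε : ℝ} (hε : 0 < ε) :
    ‖h z‖ ^ 2 ≤ ε + ‖schwarzIntegral (fun t => ‖h t‖ ^ 2) z‖ := by
  set V := schwarzIntegral (fun t => ‖h t‖ ^ 2)
  have hmc : Continuous fun t : ℝ => ‖h t‖ ^ 2 := (continuous_comp_ofReal ha).norm.pow 2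
  have hm0 (t : ℝ) : 0 ≤ ‖h t‖ ^ 2 := sq_nonneg _
  have hVre {u : ℂ} (hu : u ∈ upperHalf) : 0 ≤ (V u).re := re_schwarzIntegral_nonneg hmc hm0 hi hu
  have hlow (u : ℂ) : ε + (V u).re ≤ ‖(ε : ℂ) + V u‖ := by
    simpa using Complex.re_le_norm ((ε : ℂ) + V u)
  have hlow' {u : ℂ} (hu : u ∈ upperHalf) : ε ≤ ‖(ε : ℂ) + V u‖ := by
    linarith [hlow u, hVre hu]
  have hHn (u : ℂ) : ‖h u ^ 2 / ((ε : ℂ) + V u)‖ = ‖h u‖ ^ 2 / ‖(ε : ℂ) + V u‖ := by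
    rw [norm_div, norm_pow]
  have hHle {u : ℂ} (hu : u ∈ upperHalf) : ‖h u ^ 2 / ((ε : ℂ) + V u)‖ ≤ ‖h u‖ ^ 2 / ε := by
    rw [hHn]
    exact div_le_div_of_nonneg_left (sq_nonneg _) hε (hlow' hu)
  obtain ⟨C, hC, hgrowth⟩ := exists_norm_sq_div_le_exp hbt hε
  have hone : ‖h z ^ 2 / ((ε : ℂ) + V z)‖ ≤ 1 := by
    refine norm_le_one_of_boundary (H := fun u => h u ^ 2 / ((ε : ℂ) + V u))
      (((differentiableOn_upperHalf ha).pow 2).div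
      ((differentiableOn_schwarzIntegral hmc hm0 hi).const_add _)
      fun u hu => norm_pos_iff.1 (hε.trans_le (hlow' hu))) hC
      (fun u hu => (hHle hu).trans (hgrowth u hu)) (fun x => ?_) (fun η hη => ?_) hz
    · filter_upwards [eventually_norm_sq_le_add_re_schwarzIntegral ha hi x hε] with u hu
      exact (hHn u).trans_le (div_le_one_of_le₀ (hu.trans (hlow u)) (norm_nonneg _))
    · filter_upwards [eventually_norm_sq_div_le_exp (meanType_nonpos_iff.1 hmt) hε hη,
        eventually_gt_atTop 0] with y hy hy0
      exact (hHle (I_mul_ofReal_mem_upperHalf hy0)).trans hy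
  rw [hHn, div_le_one (hε.trans_le (hlow' hz))] at hone
  refine hone.trans ((norm_add_le _ _).trans_eq ?_)
  rw [Complex.norm_of_nonneg hε.le]

theorem norm_sq_mul_im_le_integral (hbt : IsBoundedType h) (hmt : meanType h ≤ 0)
    (ha : AnalyticOnNhd ℂ h {z | 0 ≤ z.im}) (hi : Integrable fun t : ℝ => ‖h t‖ ^ 2)
    (hz : z ∈ upperHalf) : ‖h z‖ ^ 2 * z.im ≤ ∫ t : ℝ, ‖h t‖ ^ 2 := by
  rw [← le_div_iff₀ hz]
  refine (le_of_forall_pos_le_add fun ε hε => ?_).trans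
    (norm_schwarzIntegral_le (fun t => sq_nonneg _) hi hz)
  rw [add_comm]
  exact norm_sq_le_add_norm_schwarzIntegral ha hi hbt hmt hz hε

theorem IsBoundedType.isHardy (hbt : IsBoundedType h) (hmt : meanType h ≤ 0)
    (ha : AnalyticOnNhd ℂ h {z | 0 ≤ z.im}) (hi : Integrable fun t : ℝ => ‖h t‖ ^ 2) :
    IsHardy h :=
  ⟨ha, hi, _, fun _ hz => norm_sq_mul_im_le_integral hbt hmt ha hi hz⟩

theorem IsHardy.eventually_norm_sq_le_exp (hh : IsHardy h) {ε : ℝ} (hε : 0 < ε) :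
    ∀ᶠ y : ℝ in atTop, ‖h (Complex.I * y)‖ ^ 2 ≤ Real.exp (ε * y) := by
  obtain ⟨C, hC⟩ := hh.bound
  filter_upwards [eventually_ge_atTop C, eventually_gt_atTop 0] with y hyC hy0
  have hle := hC (Complex.I * y) (I_mul_ofReal_mem_upperHalf hy0)
  simp only [Complex.mul_im, Complex.I_re, Complex.I_im, Complex.ofReal_re, Complex.ofReal_im,
    zero_mul, one_mul, zero_add] at hle
  exact (le_of_mul_le_mul_right (by linarith : _ ≤ 1 * y) hy0).trans
    (Real.one_le_exp (by positivity))

theorem IsHardy.meanType_nonpos (hh : IsHardy h) : meanType h ≤ 0 := by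
  refine meanType_nonpos_iff.2 fun ε hε => ?_
  filter_upwards [hh.eventually_norm_sq_le_exp (by positivity : 0 < 2 * ε)] with y hy
  rw [mul_assoc, show (2 : ℝ) = (2 : ℕ) from rfl, Real.exp_nat_mul] at hy
  exact (pow_le_pow_iff_left₀ (norm_nonneg _) (Real.exp_pos _).le two_ne_zero).1 hy

theorem IsHardy.norm_sq_le_exp_re_schwarzIntegral (hh : IsHardy h) (hz : z ∈ upperHalf) :
    ‖h z‖ ^ 2 ≤ Real.exp (schwarzIntegral (fun t => ‖h t‖ ^ 2) z).re := by
  set V := schwarzIntegral (fun t => ‖h t‖ ^ 2)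
  have hmc : Continuous fun t : ℝ => ‖h t‖ ^ 2 :=
    (continuous_comp_ofReal hh.analyticOnNhd).norm.pow 2
  have hm0 (t : ℝ) : 0 ≤ ‖h t‖ ^ 2 := sq_nonneg _
  have hHn (u : ℂ) : ‖h u ^ 2 * Complex.exp (-V u)‖ = ‖h u‖ ^ 2 / Real.exp (V u).re := by
    rw [norm_mul, norm_pow, Complex.norm_exp, Complex.neg_re, Real.exp_neg, div_eq_mul_inv]
  have hHle {u : ℂ} (hu : u ∈ upperHalf) : ‖h u ^ 2 * Complex.exp (-V u)‖ ≤ ‖h u‖ ^ 2 := by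
    rw [hHn]
    exact div_le_self (sq_nonneg _)
      (Real.one_le_exp (re_schwarzIntegral_nonneg hmc hm0 hh.integrable hu))
  obtain ⟨C, hC⟩ := hh.bound
  have hone : ‖h z ^ 2 * Complex.exp (-V z)‖ ≤ 1 := by
    refine norm_le_one_of_boundary (H := fun u => h u ^ 2 * Complex.exp (-V u)) (C := |C|)
      (((differentiableOn_upperHalf hh.analyticOnNhd).pow 2).mul
        (differentiableOn_schwarzIntegral hmc hm0 hh.integrable).neg.cexp) (abs_nonneg C)
      (fun u (hu : 0 < u.im) => (hHle hu).trans ?_) (fun x => ?_) (fun η hη => ?_) hz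
    · calc ‖h u‖ ^ 2 ≤ |C| * (1 / u.im) := by
            rw [mul_one_div, le_div_iff₀ hu]
            exact (hC u hu).trans (le_abs_self C)
        _ ≤ |C| * ((1 + ‖u‖ ^ 2) / u.im) := by
            gcongr
            exact le_add_of_nonneg_right (sq_nonneg _)
        _ ≤ _ := (le_add_of_nonneg_right zero_le_one).trans (Real.add_one_le_exp _)
    · filter_upwards [eventually_norm_sq_le_add_re_schwarzIntegral hh.analyticOnNhd hh.integrable x
        one_pos] with u hu
      rw [hHn, div_le_one (Real.exp_pos _)]
      exact (hu.trans_eq (add_comm _ _)).trans (Real.add_one_le_exp _)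
    · filter_upwards [hh.eventually_norm_sq_le_exp hη, eventually_gt_atTop 0] with y hy hy0
      exact (hHle (I_mul_ofReal_mem_upperHalf hy0)).trans hy
  rwa [hHn, div_le_one (Real.exp_pos _)] at hone

theorem IsHardy.isBoundedType (hh : IsHardy h) : IsBoundedType h := by
  set V := schwarzIntegral (fun t => ‖h t‖ ^ 2)
  have hmc : Continuous fun t : ℝ => ‖h t‖ ^ 2 :=
    (continuous_comp_ofReal hh.analyticOnNhd).norm.pow 2
  have hm0 (t : ℝ) : 0 ≤ ‖h t‖ ^ 2 := sq_nonneg _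
  have hq : DifferentiableOn ℂ (fun z => Complex.exp (-V z)) upperHalf :=
    (differentiableOn_schwarzIntegral hmc hm0 hh.integrable).neg.cexp
  have hqn (z : ℂ) : ‖Complex.exp (-V z)‖ = (Real.exp (V z).re)⁻¹ := by
    rw [Complex.norm_exp, Complex.neg_re, Real.exp_neg]
  have hq1 {z : ℂ} (hz : z ∈ upperHalf) : 1 ≤ Real.exp (V z).re :=
    Real.one_le_exp (re_schwarzIntegral_nonneg hmc hm0 hh.integrable hz)
  have hd := differentiableOn_upperHalf hh.analyticOnNhd
  refine ⟨hd, _, _, hd.mul hq, hq, ⟨1, fun z hz => ?_⟩, ⟨1, fun z hz => ?_⟩,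
    ⟨Complex.I, by simp [upperHalf], Complex.exp_ne_zero _⟩, fun z _ => rfl⟩
  · rw [Pi.mul_apply, norm_mul, hqn, ← div_eq_mul_inv, div_le_one (Real.exp_pos _)]
    refine abs_le_of_sq_le_sq' ?_ (Real.exp_pos _).le |>.2
    exact (hh.norm_sq_le_exp_re_schwarzIntegral hz).trans
      (le_self_pow₀ (hq1 hz) two_ne_zero)
  · rw [hqn]
    exact inv_le_one_of_one_le₀ (hq1 hz)

theorem IsHardy.norm_sq_mul_im_le (hh : IsHardy h) (hz : z ∈ upperHalf) :
    ‖h z‖ ^ 2 * z.im ≤ ∫ t : ℝ, ‖h t‖ ^ 2 :=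
  norm_sq_mul_im_le_integral hh.isBoundedType hh.meanType_nonpos hh.analyticOnNhd hh.integrable hz

end Hardy

section Cauchy

variable {u : ℂ → ℂ} {x : ℝ}

theorem analyticOnNhd_dslope {s : Set ℂ} {w : ℂ} (hu : AnalyticOnNhd ℂ u s) (hw : w ∈ s) :
    AnalyticOnNhd ℂ (dslope u w) s := by
  have hd : DifferentiableOn ℂ (dslope u w) {z | AnalyticAt ℂ u z} :=
    (Complex.differentiableOn_dslope ((isOpen_analyticAt ℂ u).mem_nhds (hu w hw))).2
      fun z hz => hz.differentiableAt.differentiableWithinAt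
  exact fun z hz => hd.analyticAt ((isOpen_analyticAt ℂ u).mem_nhds (hu z hz))

theorem norm_integral_le_of_norm_le_rpow {f : ℝ → ℂ} {D R : ℝ} (hR : 0 < R)
    (hf : ∀ y ∈ Set.Ioc 0 R, ‖f y‖ ≤ D * y ^ (-(1 / 2) : ℝ)) :
    ‖∫ y in (0 : ℝ)..R, f y‖ ≤ 2 * D * R ^ (1 / 2 : ℝ) := by
  refine (intervalIntegral.norm_integral_le_of_norm_le hR.le (Eventually.of_forall hf)
    ((intervalIntegral.intervalIntegrable_rpow' (by norm_num)).const_mul D)).trans_eq ?_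
  rw [intervalIntegral.integral_const_mul, integral_rpow (Or.inl (by norm_num)),
    Real.zero_rpow (by norm_num), show (-(1 / 2) + 1 : ℝ) = 1 / 2 by norm_num]
  ring

/-- The contour is closed by the other three sides of a square; the singularity `(Im z)^(-1/2)`
permitted on the real axis is integrable along the vertical sides. -/
theorem norm_integral_le_of_rectangle {k : ℂ → ℂ} (hk : AnalyticOnNhd ℂ k {z | 0 ≤ z.im}) {D R : ℝ}
    (hR : 0 < R)
    (hb : ∀ z ∈ upperHalf, R ≤ ‖z - x‖ → ‖k z‖ ≤ D * z.im ^ (-(1 / 2) : ℝ)) :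
    ‖∫ t : ℝ in x - R..x + R, k t‖ ≤ 6 * D * R ^ (1 / 2 : ℝ) := by
  have hrect := Complex.integral_boundary_rect_eq_zero_of_differentiableOn k (x - R : ℝ)
    ((x + R : ℝ) + R * Complex.I) (fun z hz => by
      have him := hz.2
      simp only [Complex.ofReal_im, Complex.add_im, Complex.mul_I_im, Complex.ofReal_re, zero_add,
        Set.mem_preimage, Set.uIcc_of_le hR.le] at him
      exact (hk z him.1).differentiableAt.differentiableWithinAt)
  simp only [Complex.ofReal_re, Complex.ofReal_im, Complex.add_re, Complex.mul_I_re, neg_zero,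
    add_zero, Complex.add_im, Complex.mul_I_im, zero_add, Complex.ofReal_zero, zero_mul] at hrect
  have hpoint {a y : ℝ} (hy : 0 < y) (hfar : R ≤ ‖(a + y * Complex.I : ℂ) - x‖) :
      ‖k (a + y * Complex.I)‖ ≤ D * y ^ (-(1 / 2) : ℝ) := by
    simpa using hb (a + y * Complex.I) (by simpa [upperHalf] using hy) hfar
  have htop : ‖∫ a : ℝ in x - R..x + R, k (a + R * Complex.I)‖ ≤ 2 * D * R ^ (1 / 2 : ℝ) := by
    refine (intervalIntegral.norm_integral_le_of_norm_le_const fun a _ => hpoint hR ?_).trans_eq ?_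
    · simpa using (le_abs_self _).trans (Complex.abs_im_le_norm ((a + R * Complex.I : ℂ) - x))
    · rw [add_sub_sub_cancel, abs_of_pos (by positivity), Real.rpow_neg hR.le,
        ← Real.sqrt_eq_rpow]
      field_simp
      rw [Real.sq_sqrt hR.le]; ring
  have hside {a : ℝ} (ha : |a - x| = R) :
      ‖∫ y : ℝ in (0 : ℝ)..R, k (a + y * Complex.I)‖ ≤ 2 * D * R ^ (1 / 2 : ℝ) := by
    refine norm_integral_le_of_norm_le_rpow hR fun y hy => hpoint hy.1 (ha ▸ ?_)
    simpa using Complex.abs_re_le_norm ((a + y * Complex.I : ℂ) - x)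
  have hright := hside (a := x + R) (by rw [add_sub_cancel_left, abs_of_pos hR])
  have hleft := hside (a := x - R) (by rw [sub_sub_cancel_left, abs_neg, abs_of_pos hR])
  have hsplit : (∫ t : ℝ in x - R..x + R, k t) = (∫ a : ℝ in x - R..x + R, k (a + R * Complex.I)) -
      Complex.I • (∫ y : ℝ in (0 : ℝ)..R, k ((x + R : ℝ) + y * Complex.I)) +
      Complex.I • (∫ y : ℝ in (0 : ℝ)..R, k ((x - R : ℝ) + y * Complex.I)) := by
    linear_combination hrect
  rw [hsplit]
  refine (norm_add_le _ _).trans ((add_le_add_left (norm_sub_le _ _) _).trans ?_)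
  rw [norm_smul, norm_smul, Complex.norm_I, one_mul, one_mul]
  linarith

theorem integral_eq_zero_of_decay {k : ℂ → ℂ} (hk : AnalyticOnNhd ℂ k {z | 0 ≤ z.im})
    (hi : Integrable fun t : ℝ => k t) {C : ℝ}
    (hb : ∀ z ∈ upperHalf, ‖k z‖ ^ 2 * (‖z - x‖ ^ 2 * z.im) ≤ C) : ∫ t : ℝ, k t = 0 := by
  have hstep {R : ℝ} (hR : 0 < R) :
      ‖∫ t : ℝ in x - R..x + R, k t‖ ≤ 6 * √C * R ^ (-(1 / 2) : ℝ) := by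
    refine (norm_integral_le_of_rectangle (D := √C / R) hk hR fun z (hz : 0 < z.im) hfar => ?_
      ).trans_eq ?_
    · rw [Real.rpow_neg hz.le, ← Real.sqrt_eq_rpow, ← div_eq_mul_inv, div_div,
        le_div_iff₀ (by positivity)]
      refine Real.le_sqrt_of_sq_le (le_trans ?_ (hb z hz))
      rw [mul_pow, mul_pow, Real.sq_sqrt hz.le]
      gcongr
    · rw [Real.rpow_neg hR.le, ← Real.sqrt_eq_rpow]
      field_simp
      rw [Real.sq_sqrt hR.le]
  have hlim : Tendsto (fun R : ℝ => 6 * √C * R ^ (-(1 / 2) : ℝ)) atTop (𝓝 0) := by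
    simpa using (tendsto_rpow_neg_atTop (by norm_num : (0 : ℝ) < 1 / 2)).const_mul (6 * √C)
  refine tendsto_nhds_unique (intervalIntegral_tendsto_integral hi
    (tendsto_atBot_add_const_left _ x tendsto_neg_atTop_atBot)
    (tendsto_atTop_add_const_left _ x tendsto_id)) (squeeze_zero_norm' ?_ hlim)
  filter_upwards [eventually_gt_atTop 0] with R hR using hstep hR

theorem integrable_inv_one_add_sub_sq (x : ℝ) : Integrable fun t : ℝ => (1 + (t - x) ^ 2)⁻¹ :=
  integrable_inv_one_add_sq.comp_sub_right x

theorem integral_inv_one_add_sub_sq (x : ℝ) : ∫ t : ℝ, (1 + (t - x) ^ 2)⁻¹ = Real.pi := by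
  rw [integral_sub_right_eq_self (fun t : ℝ => (1 + t ^ 2)⁻¹) x, integral_univ_inv_one_add_sq]

theorem norm_ofReal_sub_ofReal_sq (t x : ℝ) : ‖(t : ℂ) - x‖ ^ 2 = (t - x) ^ 2 := by
  rw [← Complex.ofReal_sub, Complex.norm_real, Real.norm_eq_abs, sq_abs]

theorem exists_norm_le_of_norm_sub_le_one (hu : AnalyticOnNhd ℂ u {z | 0 ≤ z.im}) (w : ℂ) :
    ∃ M : ℝ, ∀ z : ℂ, 0 ≤ z.im → ‖z - w‖ ≤ 1 → ‖u z‖ ≤ M := by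
  obtain ⟨M, hM⟩ := ((isCompact_closedBall w 1).inter_right
    (isClosed_le continuous_const Complex.continuous_im)).exists_bound_of_continuousOn (f := u)
      fun z hz => (hu z hz.2).continuousAt.continuousWithinAt
  exact ⟨M, fun z hz hzw => hM z ⟨mem_closedBall_iff_norm.2 hzw, hz⟩⟩

theorem IsHardy.of_norm_mul_norm_sub_le (hu : AnalyticOnNhd ℂ u {z | 0 ≤ z.im}) {C : ℝ}
    (hC : ∀ z : ℂ, 0 ≤ z.im → ‖u z‖ * ‖z - x‖ ≤ C) : IsHardy u := by
  obtain ⟨M, hM⟩ := exists_norm_le_of_norm_sub_le_one hu x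
  have hdecay {z : ℂ} (hz : 0 ≤ z.im) : ‖u z‖ ^ 2 * (1 + ‖z - x‖ ^ 2) ≤ 2 * (M ^ 2 + C ^ 2) := by
    have hsq : ‖u z‖ ^ 2 * ‖z - x‖ ^ 2 ≤ C ^ 2 := by
      rw [← mul_pow]
      exact pow_le_pow_left₀ (by positivity) (hC z hz) 2
    rcases le_total ‖z - x‖ 1 with hle | hle
    · have hnear : ‖u z‖ ^ 2 ≤ M ^ 2 := pow_le_pow_left₀ (norm_nonneg _) (hM z hz hle) 2
      linarith [sq_nonneg C, sq_nonneg M]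
    · have hfar : ‖u z‖ ^ 2 ≤ ‖u z‖ ^ 2 * ‖z - x‖ ^ 2 :=
        le_mul_of_one_le_right (sq_nonneg _) (one_le_pow₀ hle)
      linarith [sq_nonneg M]
  refine ⟨hu, ?_, 2 * (M ^ 2 + C ^ 2), fun z hz => (mul_le_mul_of_nonneg_left ?_
    (sq_nonneg _)).trans (hdecay hz.le)⟩
  · refine ((integrable_inv_one_add_sub_sq x).const_mul (2 * (M ^ 2 + C ^ 2))).mono'
      ((continuous_comp_ofReal hu).norm.pow 2).aestronglyMeasurable
      (Eventually.of_forall fun t => ?_)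
    rw [Real.norm_of_nonneg (sq_nonneg _), ← div_eq_mul_inv, le_div_iff₀ (by positivity),
      ← norm_ofReal_sub_ofReal_sq]
    exact hdecay (by simp)
  · linarith [im_le_norm_sub_ofReal z x, sq_nonneg (‖z - x‖ - 1), norm_nonneg (z - x)]

theorem IsHardy.add {f g : ℂ → ℂ} (hf : IsHardy f) (hg : IsHardy g) : IsHardy (f + g) := by
  have hle (z : ℂ) : ‖(f + g) z‖ ^ 2 ≤ 2 * (‖f z‖ ^ 2 + ‖g z‖ ^ 2) :=
    (pow_le_pow_left₀ (norm_nonneg _) (norm_add_le _ _) 2).trans (add_sq_le ..)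
  have ha := hf.analyticOnNhd.add hg.analyticOnNhd
  obtain ⟨C₁, h₁⟩ := hf.bound
  obtain ⟨C₂, h₂⟩ := hg.bound
  refine ⟨ha, ?_, 2 * (C₁ + C₂), fun z hz => ?_⟩
  · refine ((hf.integrable.add hg.integrable).const_mul 2).mono'
      ((continuous_comp_ofReal ha).norm.pow 2).aestronglyMeasurable
      (Eventually.of_forall fun t => ?_)
    rw [Real.norm_of_nonneg (sq_nonneg _)]
    exact hle t
  · linarith [mul_le_mul_of_nonneg_right (hle z) hz.le, h₁ z hz, h₂ z hz]

theorem IsHardy.const_mul {f : ℂ → ℂ} (hf : IsHardy f) (c : ℂ) : IsHardy fun z => c * f z := by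
  obtain ⟨C, h⟩ := hf.bound
  refine ⟨fun z hz => analyticAt_const.mul (hf.analyticOnNhd z hz), ?_, ‖c‖ ^ 2 * C,
    fun z hz => ?_⟩
  · simpa only [norm_mul, mul_pow] using hf.integrable.const_mul (‖c‖ ^ 2)
  · rw [norm_mul, mul_pow, mul_assoc]
    exact mul_le_mul_of_nonneg_left (h z hz) (by positivity)

theorem IsHardy.sub {f g : ℂ → ℂ} (hf : IsHardy f) (hg : IsHardy g) : IsHardy (f - g) := by
  simpa only [neg_one_mul, sub_eq_add_neg] using! hf.add (hg.const_mul (-1))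

theorem IsHardy.mul_of_norm_le_one {f θ : ℂ → ℂ} (hf : IsHardy f)
    (hθ : AnalyticOnNhd ℂ θ {z | 0 ≤ z.im}) (hθ1 : ∀ z : ℂ, 0 ≤ z.im → ‖θ z‖ ≤ 1) :
    IsHardy (f * θ) := by
  have ha := hf.analyticOnNhd.mul hθ
  have hle {z : ℂ} (hz : 0 ≤ z.im) : ‖(f * θ) z‖ ^ 2 ≤ ‖f z‖ ^ 2 := by
    rw [Pi.mul_apply, norm_mul]
    gcongr
    exact mul_le_of_le_one_right (norm_nonneg _) (hθ1 z hz)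
  obtain ⟨C, hC⟩ := hf.bound
  refine ⟨ha, ?_, C, fun z hz => (mul_le_mul_of_nonneg_right (hle hz.le) hz.le).trans (hC z hz)⟩
  refine hf.integrable.mono' ((continuous_comp_ofReal ha).norm.pow 2).aestronglyMeasurable
    (Eventually.of_forall fun t => ?_)
  rw [Real.norm_of_nonneg (sq_nonneg _)]
  exact hle (by simp)

theorem norm_sub_mul_norm_dslope {w z : ℂ} (h0 : u w = 0) :
    ‖z - w‖ * ‖dslope u w z‖ = ‖u z‖ := by
  simpa only [h0, sub_zero, norm_smul] using congrArg norm (sub_smul_dslope u w z)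

theorem IsHardy.integrable_dslope (hu : IsHardy u) (h0 : u x = 0) :
    Integrable fun t : ℝ => dslope u x t := by
  have hk := analyticOnNhd_dslope hu.analyticOnNhd (w := (x : ℂ)) (by simp)
  obtain ⟨M, hM⟩ := exists_norm_le_of_norm_sub_le_one hk x
  refine (hu.integrable.add ((integrable_inv_one_add_sub_sq x).const_mul (2 * M + 1))).mono'
    (continuous_comp_ofReal hk).aestronglyMeasurable (Eventually.of_forall fun t => ?_)
  have hM0 : 0 ≤ M := (norm_nonneg _).trans (hM x (by simp) (by simp))
  have hslope := norm_sub_mul_norm_dslope (z := t) h0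
  have hs := norm_ofReal_sub_ofReal_sq t x
  set s := ‖(t : ℂ) - x‖
  rw [Pi.add_apply, ← hs, ← hslope, ← sub_le_iff_le_add', ← div_eq_mul_inv,
    le_div_iff₀ (by positivity)]
  set κ := ‖dslope u x t‖
  have hκ : 0 ≤ κ := norm_nonneg _
  rcases le_total s 1 with hle | hle
  · have hκM : κ ≤ M := hM t (by simp) hle
    have hs1 : s ^ 2 ≤ 1 := pow_le_one₀ (norm_nonneg _) hle
    nlinarith [mul_nonneg (sq_nonneg (s * κ)) (sq_nonneg s), sq_nonneg (s * κ)]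
  · have hκs : κ ≤ s * κ := le_mul_of_one_le_left hκ hle
    nlinarith [sq_nonneg (s * (s * κ) - 1 / 2), sq_nonneg (s * κ - 1 / 2)]

theorem IsHardy.integral_dslope (hu : IsHardy u) (h0 : u x = 0) :
    ∫ t : ℝ, dslope u x t = 0 := by
  obtain ⟨C, hC⟩ := hu.bound
  refine integral_eq_zero_of_decay (analyticOnNhd_dslope hu.analyticOnNhd (by simp))
    (hu.integrable_dslope h0) (C := C) (x := x) fun z hz => ?_
  rw [← mul_assoc, ← mul_pow, mul_comm ‖dslope u x z‖, norm_sub_mul_norm_dslope h0]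
  exact hC z hz

theorem sub_add_I_ne_zero (x : ℝ) {z : ℂ} (hz : 0 ≤ z.im) : z - x + Complex.I ≠ 0 := by
  refine fun h => absurd (congrArg Complex.im h) ?_
  simpa using (by positivity : z.im + 1 ≠ 0)

theorem isHardy_I_div_sub_add_I (x : ℝ) :
    IsHardy fun z : ℂ => Complex.I / (z - x + Complex.I) := by
  refine IsHardy.of_norm_mul_norm_sub_le (x := x) (C := 1) (fun z hz => analyticAt_const.div
    ((analyticAt_id.sub analyticAt_const).add analyticAt_const) (sub_add_I_ne_zero x hz))
    fun z hz => ?_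
  rw [norm_div, Complex.norm_I, one_div, inv_mul_le_one₀ (norm_pos_iff.2 (sub_add_I_ne_zero x hz)),
    ← sq_le_sq₀ (norm_nonneg _) (norm_nonneg _), Complex.sq_norm, Complex.sq_norm,
    Complex.normSq_apply, Complex.normSq_apply]
  simp only [Complex.sub_re, Complex.ofReal_re, Complex.sub_im, Complex.ofReal_im, sub_zero,
    Complex.add_re, Complex.I_re, add_zero, Complex.add_im, Complex.I_im]
  nlinarith [hz]

theorem IsHardy.exists_isHardy_sub_vanishing {a : ℂ → ℂ} (ha : IsHardy a) (x : ℝ) :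
    ∃ u, IsHardy u ∧ u x = 0 ∧ ∀ z, u z = a z - a x * (Complex.I / (z - x + Complex.I)) :=
  ⟨_, ha.sub ((isHardy_I_div_sub_add_I x).const_mul (a x)), by simp, fun _ => rfl⟩

theorem IsHardy.integral_sub_conj_div {a b : ℂ → ℂ} (ha : IsHardy a) (hb : IsHardy b)
    (hab : conj (b x) = a x) :
    ∫ t : ℝ, (a t - conj (b t)) / (t - x) = 2 * Real.pi * Complex.I * a x := by
  obtain ⟨u, hu, hux, hu_eq⟩ := ha.exists_isHardy_sub_vanishing x
  obtain ⟨v, hv, hvx, hv_eq⟩ := hb.exists_isHardy_sub_vanishing x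
  have hsplit : (fun t : ℝ => (a t - conj (b t)) / (t - x)) =ᵐ[volume] fun t : ℝ =>
      dslope u x t - conj (dslope v x t) + a x * 2 * Complex.I * ((1 + (t - x) ^ 2)⁻¹ : ℝ) := by
    filter_upwards [Measure.ae_ne volume x] with t ht
    have hs : (t : ℂ) - x ≠ 0 := sub_ne_zero.2 (by exact_mod_cast ht)
    have hadd : (t : ℂ) - x + Complex.I ≠ 0 := sub_add_I_ne_zero x (by simp)
    have hsub : (t : ℂ) - x - Complex.I ≠ 0 := by
      simpa [sub_eq_add_neg] using (map_ne_zero conj).2 hadd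
    have hsq : (((1 + (t - x) ^ 2)⁻¹ : ℝ) : ℂ) =
        ((t - x + Complex.I) * (t - x - Complex.I))⁻¹ := by
      push_cast
      congr 1
      linear_combination Complex.I_sq
    rw [dslope_of_ne _ (sub_ne_zero.1 hs), dslope_of_ne _ (sub_ne_zero.1 hs), slope_def_field,
      slope_def_field, hux, hvx, hu_eq, hv_eq, hsq]
    simp only [map_sub, map_mul, map_div₀, map_add, Complex.conj_ofReal, Complex.conj_I, hab,
      sub_zero, ← sub_eq_add_neg]
    field_simp
    ring
  have hiu := hu.integrable_dslope hux
  have hiv : Integrable fun t : ℝ => conj (dslope v x t) :=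
    Complex.conjLIE.integrable_comp_iff.2 (hv.integrable_dslope hvx)
  have hiuv : Integrable fun t : ℝ => dslope u x t - conj (dslope v x t) := hiu.sub hiv
  have hip : Integrable fun t : ℝ => a x * 2 * Complex.I * ((1 + (t - x) ^ 2)⁻¹ : ℝ) :=
    (integrable_inv_one_add_sub_sq x).ofReal.const_mul _
  rw [integral_congr_ae hsplit, integral_add hiuv hip, integral_sub hiu hiv,
    hu.integral_dslope hux, integral_conj, hv.integral_dslope hvx, integral_const_mul,
    integral_complex_ofReal, integral_inv_one_add_sub_sq, map_zero]
  ring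

end Cauchy

section Space

variable {G f g : ℂ → ℂ} {x : ℝ} {z : ℂ}

theorem sharp_sharp (f : ℂ → ℂ) : sharp (sharp f) = f := by
  funext z
  simp only [sharp, Complex.conj_conj]

theorem sharp_ofReal (f : ℂ → ℂ) (x : ℝ) : sharp f x = conj (f x) := by
  rw [sharp, Complex.conj_ofReal]

theorem norm_sharp (f : ℂ → ℂ) (z : ℂ) : ‖sharp f z‖ = ‖f (conj z)‖ := Complex.norm_conj _

theorem sharp_mul (f g : ℂ → ℂ) : sharp (fun z => f z * g z) = fun z => sharp f z * sharp g z :=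
  funext fun _ => map_mul _ _ _

theorem sharp_add (f g : ℂ → ℂ) : sharp (f + g) = sharp f + sharp g :=
  funext fun _ => map_add _ _ _

theorem sharp_const_smul (c : ℂ) (f : ℂ → ℂ) : sharp (c • f) = conj c • sharp f :=
  funext fun _ => map_mul _ _ _

theorem differentiable_sharp (hf : Differentiable ℂ f) : Differentiable ℂ (sharp f) := fun z => by
  simpa only [Complex.conj_conj] using! (hf (conj z)).conj_conj

theorem norm_sharp_div_ofReal (G g : ℂ → ℂ) (t : ℝ) : ‖sharp g t / G t‖ = ‖g t / G t‖ := by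
  rw [norm_div, norm_div, sharp_ofReal, Complex.norm_conj]

theorem normSq_sharp (G g : ℂ → ℂ) : normSq G (sharp g) = normSq G g := by
  simp only [normSq, norm_sharp_div_ofReal]

theorem normSq_nonneg (G g : ℂ → ℂ) : 0 ≤ normSq G g := integral_nonneg fun _ => sq_nonneg _

/-- A Hermite-Biehler function without real zeros, hence without zeros in the closed upper
half-plane. -/
structure IsRegularHB (G : ℂ → ℂ) : Prop extends IsHermiteBiehler G where
  ne_zero_ofReal : ∀ x : ℝ, G x ≠ 0

theorem IsRegularHB.norm_sharp_lt (hG : IsRegularHB G) (hz : 0 < z.im) : ‖sharp G z‖ < ‖G z‖ :=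
  (norm_sharp G z).trans_lt (hG.norm_lt z hz)

theorem IsRegularHB.ne_zero (hG : IsRegularHB G) (hz : 0 ≤ z.im) : G z ≠ 0 := by
  rcases hz.eq_or_lt with h0 | hpos
  · rw [show z = (z.re : ℂ) from Complex.ext rfl h0.symm]
    exact hG.ne_zero_ofReal _
  · exact norm_pos_iff.1 ((norm_nonneg _).trans_lt (hG.norm_sharp_lt hpos))

theorem IsRegularHB.norm_sharp_le (hG : IsRegularHB G) (hz : 0 ≤ z.im) :
    ‖sharp G z‖ ≤ ‖G z‖ := by
  rcases hz.eq_or_lt with h0 | hpos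
  · rw [show z = (z.re : ℂ) from Complex.ext rfl h0.symm, sharp_ofReal, Complex.norm_conj]
  · exact (hG.norm_sharp_lt hpos).le

theorem IsRegularHB.mul {E F : ℂ → ℂ} (hE : IsRegularHB E) (hF : IsRegularHB F) :
    IsRegularHB fun z => E z * F z where
  entire := hE.entire.mul hF.entire
  norm_lt z hz := by
    rw [norm_mul, norm_mul]
    exact mul_lt_mul'' (hE.norm_lt z hz) (hF.norm_lt z hz) (norm_nonneg _) (norm_nonneg _)
  ne_zero_ofReal x := mul_ne_zero (hE.ne_zero_ofReal x) (hF.ne_zero_ofReal x)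

theorem IsRegularHB.analyticOnNhd_div (hG : IsRegularHB G) (hf : Differentiable ℂ f) :
    AnalyticOnNhd ℂ (fun z => f z / G z) {z | 0 ≤ z.im} :=
  fun z hz => (hf.analyticAt z).div (hG.entire.analyticAt z) (hG.ne_zero hz)

theorem IsRegularHB.mem_space_iff (hG : IsRegularHB G) :
    g ∈ space G ↔ Differentiable ℂ g ∧ IsHardy (fun z => g z / G z) ∧
      IsHardy (fun z => sharp g z / G z) := by
  constructor
  · rintro ⟨hd, hi, ⟨hbt, hmt⟩, hbt', hmt'⟩
    refine ⟨hd, hbt.isHardy hmt (hG.analyticOnNhd_div hd) hi,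
      hbt'.isHardy hmt' (hG.analyticOnNhd_div (differentiable_sharp hd)) ?_⟩
    simpa only [norm_sharp_div_ofReal] using hi
  · rintro ⟨hd, h, h'⟩
    exact ⟨hd, h.integrable, ⟨h.isBoundedType, h.meanType_nonpos⟩, h'.isBoundedType,
      h'.meanType_nonpos⟩

/-- The de Branges space of `G` as a linear subspace of the space of all functions. -/
noncomputable def IsRegularHB.submodule (hG : IsRegularHB G) : Submodule ℂ (ℂ → ℂ) where
  carrier := space G
  add_mem' {f g} hf hg := by
    rw [hG.mem_space_iff] at hf hg ⊢
    refine ⟨hf.1.add hg.1, ?_, ?_⟩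
    · simpa only [Pi.add_apply, add_div] using! hf.2.1.add hg.2.1
    · simpa only [sharp_add, Pi.add_apply, add_div] using! hf.2.2.add hg.2.2
  zero_mem' := by
    have h0 : IsHardy fun _ => (0 : ℂ) :=
      .of_norm_mul_norm_sub_le (x := 0) (fun _ _ => analyticAt_const) (C := 0) fun z _ => by simp
    refine hG.mem_space_iff.2 ⟨differentiable_const 0, ?_, ?_⟩ <;>
      simpa only [sharp, Pi.zero_apply, map_zero, zero_div] using h0
  smul_mem' c f hf := by
    rw [hG.mem_space_iff] at hf ⊢
    refine ⟨hf.1.const_smul c, ?_, ?_⟩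
    · simpa only [Pi.smul_apply, smul_eq_mul, mul_div_assoc] using hf.2.1.const_mul c
    · simpa only [sharp_const_smul, Pi.smul_apply, smul_eq_mul, mul_div_assoc] using
        hf.2.2.const_mul (conj c)

theorem IsRegularHB.sharp_mem_space (hG : IsRegularHB G) (hg : g ∈ space G) :
    sharp g ∈ space G := by
  rw [hG.mem_space_iff] at hg ⊢
  rw [sharp_sharp]
  exact ⟨differentiable_sharp hg.1, hg.2.2, hg.2.1⟩

theorem IsRegularHB.mul_mem_space {E F : ℂ → ℂ} (hE : IsRegularHB E) (hF : IsRegularHB F)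
    (hf : f ∈ space E) : (fun z => f z * F z) ∈ space fun z => E z * F z := by
  rw [hE.mem_space_iff] at hf
  rw [(hE.mul hF).mem_space_iff, sharp_mul]
  refine ⟨hf.1.mul hF.entire, ?_, ?_⟩
  · simpa only [mul_div_mul_comm] using! hf.2.1.mul_of_norm_le_one
      (hF.analyticOnNhd_div hF.entire) fun z _ => by
        rw [norm_div]
        exact div_self_le_one _
  · simpa only [mul_div_mul_comm] using! hf.2.2.mul_of_norm_le_one
      (hF.analyticOnNhd_div (differentiable_sharp hF.entire)) fun z hz => by
        rw [norm_div]
        exact div_le_one_of_le₀ (hF.norm_sharp_le hz) (norm_nonneg _)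

end Space

section Kernel

variable {G g : ℂ → ℂ} {x : ℝ} {z : ℂ}

/-- The numerator of the reproducing kernel at a real point. -/
noncomputable def kernelNum (G : ℂ → ℂ) (x : ℝ) (z : ℂ) : ℂ :=
  conj (G x) * G z - G x * sharp G z

theorem kernelNum_self (G : ℂ → ℂ) (x : ℝ) : kernelNum G x x = 0 := by
  rw [kernelNum, sharp_ofReal, mul_comm, sub_self]

theorem kernel_ofReal (G : ℂ → ℂ) (x : ℝ) :
    kernel G x = fun z => -dslope (kernelNum G x) x z / (2 * Real.pi * Complex.I) := by
  funext z
  rw [kernel, Complex.conj_ofReal]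
  split_ifs with h
  · rw [h, dslope_same]
    rfl
  · rw [dslope_of_ne _ h, slope_def_field, kernelNum_self, sub_zero, ← div_neg, neg_sub, div_div,
      mul_comm ((x : ℂ) - z)]
    rfl

theorem differentiable_kernel (hG : Differentiable ℂ G) (x : ℝ) :
    Differentiable ℂ (kernel G x) := by
  have hnum : Differentiable ℂ (kernelNum G x) :=
    (hG.const_mul _).sub ((differentiable_sharp hG).const_mul _)
  rw [kernel_ofReal]
  exact fun z => ((analyticOnNhd_dslope (s := Set.univ) (fun z _ => hnum.analyticAt z)
    (Set.mem_univ _) z (Set.mem_univ z)).differentiableAt.neg).div_const _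

theorem kernel_mul (G : ℂ → ℂ) (x : ℝ) (z : ℂ) :
    kernel G x z * (2 * Real.pi * Complex.I * (x - z)) = kernelNum G x z := by
  rw [kernel_ofReal, ← sub_smul_dslope_of_zero (kernelNum_self G x) z, smul_eq_mul, ← mul_assoc,
    div_mul_cancel₀ _ Complex.two_pi_I_ne_zero]
  ring

theorem sharp_kernelNum (G : ℂ → ℂ) (x : ℝ) (z : ℂ) :
    sharp (kernelNum G x) z = -kernelNum G x z := by
  simp only [sharp, kernelNum, map_sub, map_mul, Complex.conj_conj]
  ring

theorem sharp_kernel (hG : Differentiable ℂ G) (x : ℝ) : sharp (kernel G x) = kernel G x := by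
  refine Continuous.ext_on (dense_compl_singleton (x : ℂ))
    (differentiable_sharp (differentiable_kernel hG x)).continuous
    (differentiable_kernel hG x).continuous fun z hz => ?_
  have hzx : (2 * Real.pi * Complex.I * (x - z)) ≠ 0 :=
    mul_ne_zero Complex.two_pi_I_ne_zero (sub_ne_zero.2 (Ne.symm hz))
  have hconj := congrArg conj (kernel_mul G x (conj z))
  simp only [map_mul, map_sub, Complex.conj_conj, Complex.conj_ofReal, Complex.conj_I,
    map_ofNat] at hconj
  refine mul_right_cancel₀ hzx ?_
  rw [kernel_mul, ← neg_eq_iff_eq_neg.2 (sharp_kernelNum G x z), sharp, sharp, ← hconj]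
  ring

theorem IsRegularHB.norm_kernel_div_mul_le (hG : IsRegularHB G) (x : ℝ) (hz : 0 ≤ z.im) :
    ‖kernel G x z / G z‖ * ‖z - x‖ ≤ ‖G x‖ := by
  have hnum : ‖kernelNum G x z‖ ≤ 2 * ‖G x‖ * ‖G z‖ := by
    refine (norm_sub_le _ _).trans ?_
    rw [norm_mul, norm_mul, Complex.norm_conj]
    linarith [mul_le_mul_of_nonneg_left (hG.norm_sharp_le hz) (norm_nonneg (G x))]
  have hker := congrArg norm (kernel_mul G x z)
  simp only [norm_mul, norm_sub_rev (x : ℂ), Complex.norm_I, Complex.norm_real, Real.norm_eq_abs,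
    abs_of_pos Real.pi_pos, Complex.norm_ofNat, mul_one] at hker
  rw [norm_div, div_mul_eq_mul_div, div_le_iff₀ (norm_pos_iff.2 (hG.ne_zero hz))]
  have hnonneg : 0 ≤ ‖kernel G x z‖ * ‖z - x‖ := by positivity
  nlinarith [Real.pi_gt_three]

theorem IsRegularHB.kernel_mem_space (hG : IsRegularHB G) (x : ℝ) : kernel G x ∈ space G := by
  have hd := differentiable_kernel hG.entire x
  have hh : IsHardy fun z => kernel G x z / G z := .of_norm_mul_norm_sub_le
    (hG.analyticOnNhd_div hd) fun z hz => hG.norm_kernel_div_mul_le x hz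
  exact hG.mem_space_iff.2 ⟨hd, hh, by rwa [sharp_kernel hG.entire]⟩

theorem IsRegularHB.integral_conj_kernel_mul (hG : IsRegularHB G) (hg : g ∈ space G) (x : ℝ) :
    ∫ t : ℝ, conj (kernel G x t / G t) * (g t / G t) = g x := by
  obtain ⟨-, hleft, hright⟩ := hG.mem_space_iff.1 hg
  have hGx (t : ℝ) : G t ≠ 0 := hG.ne_zero_ofReal t
  have hcauchy := (hleft.const_mul (G x)).integral_sub_conj_div (x := x) (hright.const_mul (G x))
    (by simp only [map_mul, map_div₀, sharp_ofReal, Complex.conj_conj]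
        field_simp [hGx x, (map_ne_zero conj).2 (hGx x)])
  rw [mul_div_cancel₀ _ (hGx x)] at hcauchy
  refine mul_left_cancel₀ Complex.two_pi_I_ne_zero ?_
  rw [← hcauchy, ← integral_const_mul]
  refine integral_congr_ae ?_
  filter_upwards [Measure.ae_ne volume x] with t ht
  have htx : (t : ℂ) - x ≠ 0 := sub_ne_zero.2 (by exact_mod_cast ht)
  have hker := congrArg conj (kernel_mul G x t)
  simp only [kernelNum, map_mul, map_sub, Complex.conj_ofReal, Complex.conj_I, sharp_ofReal,
    Complex.conj_conj, map_ofNat] at hker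
  simp only [map_div₀, map_mul, sharp_ofReal, Complex.conj_conj]
  rw [eq_div_iff htx]
  field_simp [hGx t, (map_ne_zero conj).2 (hGx t)]
  linear_combination g t * hker

end Kernel

section Entire

variable {u : ℂ → ℂ}

theorem norm_sq_sub_sq_of_norm_eq {z : ℂ} {ρ : ℝ} (hz : ‖z‖ = ρ) :
    ‖z ^ 2 - (ρ : ℂ) ^ 2‖ = 2 * ρ * |z.im| := by
  have hsq : (ρ : ℂ) ^ 2 = z * conj z := by rw [Complex.mul_conj', hz]
  rw [hsq, sq, ← mul_sub, norm_mul, hz, Complex.sub_conj, norm_mul, Complex.norm_I, mul_one,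
    Complex.norm_real, Real.norm_eq_abs, abs_mul, abs_two]
  ring

theorem norm_sq_mul_le_of_sphere (hu : Differentiable ℂ u) {ρ B : ℝ} (hρ : 0 < ρ) (p : ℕ)
    (h : ∀ z : ℂ, ‖z‖ = ρ → ‖u z‖ ^ 2 * ((2 * ρ * |z.im|) ^ p) ^ 2 ≤ B) {z : ℂ}
    (hz : ‖z‖ ≤ ρ / 2) : ‖u z‖ ^ 2 * ((3 * ρ ^ 2 / 4) ^ p) ^ 2 ≤ B := by
  have hB : 0 ≤ B := le_trans (by positivity) (h ρ (by simp [abs_of_pos hρ]))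
  have hd : Differentiable ℂ fun z => u z * (z ^ 2 - (ρ : ℂ) ^ 2) ^ p := by fun_prop
  have hmax : ‖u z * (z ^ 2 - (ρ : ℂ) ^ 2) ^ p‖ ≤ √B := by
    refine Complex.norm_le_of_forall_mem_frontier_norm_le (U := Metric.ball 0 ρ)
      Metric.isBounded_ball hd.diffContOnCl (fun w hw => ?_)
      (subset_closure (mem_ball_zero_iff.2 (by linarith)))
    rw [frontier_ball _ hρ.ne', mem_sphere_zero_iff_norm] at hw
    refine Real.le_sqrt_of_sq_le ?_
    rw [norm_mul, norm_pow, mul_pow, norm_sq_sub_sq_of_norm_eq hw]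
    exact h w hw
  have hfar : 3 * ρ ^ 2 / 4 ≤ ‖z ^ 2 - (ρ : ℂ) ^ 2‖ := by
    have htri := norm_sub_norm_le ((ρ : ℂ) ^ 2) (z ^ 2)
    rw [norm_sub_rev, norm_pow, norm_pow, Complex.norm_real, Real.norm_eq_abs, sq_abs] at htri
    nlinarith [norm_nonneg z]
  calc ‖u z‖ ^ 2 * ((3 * ρ ^ 2 / 4) ^ p) ^ 2
      ≤ ‖u z‖ ^ 2 * (‖z ^ 2 - (ρ : ℂ) ^ 2‖ ^ p) ^ 2 := by gcongr
    _ = ‖u z * (z ^ 2 - (ρ : ℂ) ^ 2) ^ p‖ ^ 2 := by rw [norm_mul, norm_pow, mul_pow]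
    _ ≤ √B ^ 2 := by gcongr
    _ = B := Real.sq_sqrt hB

theorem apply_eq_apply_zero_of_isLittleO (hu : Differentiable ℂ u)
    (h : u =o[cocompact ℂ] (id : ℂ → ℂ)) (z : ℂ) : u z = u 0 := by
  have hd : Differentiable ℂ (dslope u 0) := fun w =>
    (analyticOnNhd_dslope (s := Set.univ) (fun w _ => hu.analyticAt w) (Set.mem_univ _) w
      (Set.mem_univ w)).differentiableAt
  have hconst : (fun _ => u 0) =o[cocompact ℂ] (id : ℂ → ℂ) :=
    Asymptotics.isLittleO_const_left.2 (Or.inr (tendsto_norm_cocompact_atTop (E := ℂ)))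
  have hlim : Tendsto (dslope u 0) (cocompact ℂ) (𝓝 0) := by
    refine (h.sub hconst).tendsto_div_nhds_zero.congr' ?_
    filter_upwards [(isCompact_singleton (x := (0 : ℂ))).compl_mem_cocompact] with w hw
    rw [dslope_of_ne _ hw, slope_def_field, sub_zero, id]
  rw [← sub_eq_zero, ← sub_smul_dslope u 0 z, hd.apply_eq_of_tendsto_cocompact z hlim, smul_zero]

theorem apply_eq_apply_zero_of_norm_sq_le (hu : Differentiable ℂ u) {K : ℝ}
    (h : ∀ z : ℂ, 1 ≤ ‖z‖ → ‖u z‖ ^ 2 ≤ K * ‖z‖) (z : ℂ) : u z = u 0 := by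
  refine apply_eq_apply_zero_of_isLittleO hu (Asymptotics.isLittleO_iff.2 fun c hc => ?_) z
  filter_upwards [(tendsto_norm_cocompact_atTop (E := ℂ)).eventually_ge_atTop 1,
    (tendsto_norm_cocompact_atTop (E := ℂ)).eventually_ge_atTop (K / c ^ 2)] with w hw1 hwK
  refine abs_le_of_sq_le_sq' ?_ (by positivity) |>.2
  rw [div_le_iff₀ (by positivity)] at hwK
  calc ‖u w‖ ^ 2 ≤ K * ‖w‖ := h w hw1
    _ ≤ ‖w‖ * c ^ 2 * ‖w‖ := by gcongr
    _ = (c * ‖id w‖) ^ 2 := by rw [id]; ring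

end Entire

section Completeness

variable {G g : ℂ → ℂ}

theorem IsRegularHB.norm_sq_mul_im_le (hG : IsRegularHB G) (hg : g ∈ space G) {z : ℂ}
    (hz : 0 < z.im) : ‖g z / G z‖ ^ 2 * z.im ≤ normSq G g :=
  (hG.mem_space_iff.1 hg).2.1.norm_sq_mul_im_le hz

theorem IsRegularHB.norm_sq_mul_abs_im_le (hG : IsRegularHB G) (hg : g ∈ space G) (z : ℂ) :
    ‖g z‖ ^ 2 * |z.im| ≤ max ‖G z‖ ‖G (conj z)‖ ^ 2 * normSq G g := by
  have hupper {g : ℂ → ℂ} (hg : g ∈ space G) {z : ℂ} (hz : 0 < z.im) :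
      ‖g z‖ ^ 2 * z.im ≤ ‖G z‖ ^ 2 * normSq G g := by
    have hle := hG.norm_sq_mul_im_le hg hz
    rwa [norm_div, div_pow, div_mul_eq_mul_div, div_le_iff₀'
      (pow_pos (norm_pos_iff.2 (hG.ne_zero hz.le)) 2)] at hle
  have hN := normSq_nonneg G g
  rcases lt_trichotomy z.im 0 with hneg | h0 | hpos
  · have hle := hupper (hG.sharp_mem_space hg) (z := conj z) (by simpa using hneg)
    rw [norm_sharp, normSq_sharp, Complex.conj_conj, Complex.conj_im, ← abs_of_neg hneg] at hle
    refine hle.trans ?_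
    gcongr
    exact le_max_right _ _
  · rw [h0, abs_zero, mul_zero]
    positivity
  · rw [abs_of_pos hpos]
    refine (hupper hg hpos).trans ?_
    gcongr
    exact le_max_left _ _

theorem IsRegularHB.exists_norm_sq_le (hG : IsRegularHB G) {R : ℝ} (hR : 0 < R) :
    ∃ C : ℝ, 0 ≤ C ∧ ∀ g ∈ space G, ∀ z : ℂ, ‖z‖ ≤ R → ‖g z‖ ^ 2 ≤ C * normSq G g := by
  obtain ⟨M, hM⟩ := (isCompact_closedBall (0 : ℂ) (2 * R)).exists_bound_of_continuousOn
    hG.entire.continuous.continuousOn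
  refine ⟨4 * (2 * R) ^ 3 * M ^ 2 / (3 * (2 * R) ^ 2 / 4) ^ 2, by positivity, fun g hg z hz => ?_⟩
  have hN := normSq_nonneg G g
  have hmax := norm_sq_mul_le_of_sphere hg.1 (ρ := 2 * R) (B := 4 * (2 * R) ^ 3 * M ^ 2 *
    normSq G g) (by positivity) 1 (fun w hw => ?_) (z := z) (by linarith)
  · rwa [pow_one, ← le_div_iff₀ (by positivity), mul_div_right_comm] at hmax
  have hGM : max ‖G w‖ ‖G (conj w)‖ ≤ M :=
    max_le (hM w (by simp [hw])) (hM (conj w) (by simp [hw]))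
  have him : |w.im| ≤ 2 * R := hw ▸ Complex.abs_im_le_norm w
  have hle : ‖g w‖ ^ 2 * |w.im| ≤ M ^ 2 * normSq G g :=
    (hG.norm_sq_mul_abs_im_le hg w).trans (by gcongr)
  calc ‖g w‖ ^ 2 * ((2 * (2 * R) * |w.im|) ^ 1) ^ 2
      = 4 * (2 * R) ^ 2 * |w.im| * (‖g w‖ ^ 2 * |w.im|) := by ring
    _ ≤ 4 * (2 * R) ^ 2 * (2 * R) * (M ^ 2 * normSq G g) := by
        exact mul_le_mul (by gcongr) hle (by positivity) (by positivity)
    _ = _ := by ring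

theorem IsHardy.memLp {h : ℂ → ℂ} (hh : IsHardy h) : MemLp (fun t : ℝ => h t) 2 volume :=
  (memLp_two_iff_integrable_sq_norm
    (continuous_comp_ofReal hh.analyticOnNhd).aestronglyMeasurable).2 hh.integrable

theorem IsRegularHB.memLp (hG : IsRegularHB G) (hg : g ∈ space G) :
    MemLp (fun t : ℝ => g t / G t) 2 volume :=
  (hG.mem_space_iff.1 hg).2.1.memLp

/-- The isometric embedding `g ↦ g / G` of the de Branges space of `G` into `L²(ℝ)`. -/
noncomputable def IsRegularHB.toL2 (hG : IsRegularHB G) :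
    hG.submodule →ₗ[ℂ] Lp ℂ 2 (volume : Measure ℝ) where
  toFun g := (hG.memLp g.2).toLp
  map_add' f g := by
    rw [← MemLp.toLp_add]
    exact MemLp.toLp_congr _ _ (Eventually.of_forall fun t => add_div _ _ _)
  map_smul' c g := by
    rw [RingHom.id_apply, ← MemLp.toLp_const_smul]
    exact MemLp.toLp_congr _ _ (Eventually.of_forall fun t => mul_div_assoc _ _ _)

theorem IsRegularHB.coeFn_toL2 (hG : IsRegularHB G) (g : hG.submodule) :
    hG.toL2 g =ᵐ[volume] fun t : ℝ => g.1 t / G t :=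
  (hG.memLp g.2).coeFn_toLp

theorem IsRegularHB.inner_toL2 (hG : IsRegularHB G) (f g : hG.submodule) :
    inner ℂ (hG.toL2 f) (hG.toL2 g) = ∫ t : ℝ, conj (f.1 t / G t) * (g.1 t / G t) := by
  rw [L2.inner_def]
  refine integral_congr_ae ?_
  filter_upwards [hG.coeFn_toL2 f, hG.coeFn_toL2 g] with t hf hg
  rw [hf, hg, RCLike.inner_apply, mul_comm]

theorem IsRegularHB.norm_toL2_sq (hG : IsRegularHB G) (g : hG.submodule) :
    ‖hG.toL2 g‖ ^ 2 = normSq G g := by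
  have hinner := hG.inner_toL2 g g
  simp only [Complex.conj_mul', ← Complex.ofReal_pow] at hinner
  rw [integral_complex_ofReal, inner_self_eq_norm_sq_to_K] at hinner
  exact Complex.ofReal_injective ((Complex.ofReal_pow _ _).trans hinner)

theorem IsRegularHB.exists_tendsto_of_cauchySeq (hG : IsRegularHB G) {g : ℕ → hG.submodule}
    (hg : CauchySeq fun n => hG.toL2 (g n)) :
    ∃ g₀ : ℂ → ℂ, Differentiable ℂ g₀ ∧ ∀ z, Tendsto (fun n => (g n).1 z) atTop (𝓝 (g₀ z)) := by
  have hcauchy {R : ℝ} (hR : 0 < R) :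
      UniformCauchySeqOn (fun n => (g n).1) atTop (Metric.ball 0 R) := by
    obtain ⟨C, hC0, hC⟩ := hG.exists_norm_sq_le hR
    rw [Metric.uniformCauchySeqOn_iff]
    intro ε hε
    obtain ⟨N, hN⟩ := Metric.cauchySeq_iff.1 hg (ε / (√C + 1)) (by positivity)
    refine ⟨N, fun m hm n hn z hz => ?_⟩
    have hdist := hN m hm n hn
    rw [dist_eq_norm, ← map_sub, lt_div_iff₀ (by positivity)] at hdist
    have heval : ‖(g m).1 z - (g n).1 z‖ ≤ √C * ‖hG.toL2 (g m - g n)‖ := by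
      refine abs_le_of_sq_le_sq' ?_ (by positivity) |>.2
      rw [mul_pow, Real.sq_sqrt hC0, hG.norm_toL2_sq]
      exact hC _ (g m - g n).2 z (mem_ball_zero_iff.1 hz).le
    rw [dist_eq_norm]
    linarith [norm_nonneg (hG.toL2 (g m - g n))]
  have hlim (z : ℂ) : ∃ l, Tendsto (fun n => (g n).1 z) atTop (𝓝 l) :=
    cauchySeq_tendsto_of_complete
      ((hcauchy (by positivity : 0 < ‖z‖ + 1)).cauchySeq (mem_ball_zero_iff.2 (lt_add_one _)))
  choose g₀ hg₀ using hlim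
  refine ⟨g₀, fun z => ?_, hg₀⟩
  have hunif := (hcauchy (by positivity : 0 < ‖z‖ + 1)).tendstoUniformlyOn_of_tendsto
    fun w _ => hg₀ w
  exact (hunif.tendstoLocallyUniformlyOn.differentiableOn
    (Eventually.of_forall fun n => (g n).2.1.differentiableOn) Metric.isOpen_ball).differentiableAt
      (Metric.isOpen_ball.mem_nhds (mem_ball_zero_iff.2 (lt_add_one _)))

theorem IsRegularHB.norm_sq_mul_im_le_of_tendsto (hG : IsRegularHB G) {g : ℕ → hG.submodule}
    {g₀ : ℂ → ℂ} (hg₀ : ∀ z, Tendsto (fun n => (g n).1 z) atTop (𝓝 (g₀ z)))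
    {k : Lp ℂ 2 (volume : Measure ℝ)} (hk : Tendsto (fun n => hG.toL2 (g n)) atTop (𝓝 k)) {z : ℂ}
    (hz : 0 < z.im) :
    ‖g₀ z / G z‖ ^ 2 * z.im ≤ ‖k‖ ^ 2 ∧ ‖sharp g₀ z / G z‖ ^ 2 * z.im ≤ ‖k‖ ^ 2 := by
  have hnorm := hk.norm.pow 2
  simp only [hG.norm_toL2_sq] at hnorm
  have hsharp : Tendsto (fun n => sharp (g n).1 z) atTop (𝓝 (sharp g₀ z)) :=
    (Complex.continuous_conj.tendsto _).comp (hg₀ (conj z))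
  constructor
  · exact le_of_tendsto_of_tendsto' ((((hg₀ z).div_const _).norm.pow 2).mul_const _) hnorm
      fun n => hG.norm_sq_mul_im_le (g n).2 hz
  · refine le_of_tendsto_of_tendsto' (((hsharp.div_const _).norm.pow 2).mul_const _) hnorm
      fun n => ?_
    rw [← normSq_sharp]
    exact hG.norm_sq_mul_im_le (hG.sharp_mem_space (g n).2) hz

theorem IsRegularHB.isClosed_range_toL2 (hG : IsRegularHB G) :
    IsClosed (LinearMap.range hG.toL2 : Set (Lp ℂ 2 (volume : Measure ℝ))) := by
  refine IsSeqClosed.isClosed fun k k₀ hk hlim => ?_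
  choose g hg using hk
  obtain rfl : k = fun n => hG.toL2 (g n) := funext fun n => (hg n).symm
  obtain ⟨g₀, hg₀d, hg₀⟩ := hG.exists_tendsto_of_cauchySeq hlim.cauchySeq
  have hae : k₀ =ᵐ[volume] fun t : ℝ => g₀ t / G t := by
    obtain ⟨ns, hns, hnsae⟩ := (tendstoInMeasure_of_tendsto_Lp hlim).exists_seq_tendsto_ae
    filter_upwards [hnsae, ae_all_iff.2 fun n => hG.coeFn_toL2 (g n)] with t hk hg
    simp only [hg] at hk
    exact tendsto_nhds_unique hk (((hg₀ t).comp hns.tendsto_atTop).div_const _)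
  have hint : Integrable fun t : ℝ => ‖g₀ t / G t‖ ^ 2 :=
    ((memLp_congr_ae hae).1 (Lp.memLp k₀)).integrable_norm_pow two_ne_zero
  have hmem : g₀ ∈ space G := by
    refine hG.mem_space_iff.2 ⟨hg₀d,
      ⟨hG.analyticOnNhd_div hg₀d, hint, _, fun z hz =>
        (hG.norm_sq_mul_im_le_of_tendsto hg₀ hlim hz).1⟩,
      ⟨hG.analyticOnNhd_div (differentiable_sharp hg₀d), ?_, _, fun z hz =>
        (hG.norm_sq_mul_im_le_of_tendsto hg₀ hlim hz).2⟩⟩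
    simpa only [norm_sharp_div_ofReal] using hint
  exact ⟨⟨g₀, hmem⟩, Lp.ext ((hG.coeFn_toL2 _).trans hae.symm)⟩

end Completeness

section Liouville

variable {G g u A : ℂ → ℂ}

/-- `G + G*`, which is twice the function usually called `A` in the decomposition `G = A - iB` of a
Hermite–Biehler function into functions that are real on the real axis. -/
noncomputable def realPart (G : ℂ → ℂ) : ℂ → ℂ := G + sharp G

theorem differentiable_realPart (hG : Differentiable ℂ G) : Differentiable ℂ (realPart G) :=
  hG.add (differentiable_sharp hG)

theorem sharp_realPart (G : ℂ → ℂ) : sharp (realPart G) = realPart G := by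
  rw [realPart, sharp_add, sharp_sharp, add_comm]

theorem realPart_mul (f g : ℂ → ℂ) (z : ℂ) :
    realPart (fun z => f z * g z) z = f z * g z + sharp f z * sharp g z := by
  rw [realPart, Pi.add_apply, sharp_mul]

theorem norm_realPart_conj (G : ℂ → ℂ) (z : ℂ) : ‖realPart G (conj z)‖ = ‖realPart G z‖ := by
  rw [← norm_sharp, sharp_realPart]

theorem IsRegularHB.exists_mul_norm_le_norm_realPart (hG : IsRegularHB G) :
    ∃ c : ℝ, 0 < c ∧ ∀ z ∈ upperHalf,
      c * (z.im / (1 + ‖z‖ ^ 2)) * ‖G z‖ ≤ ‖realPart G z‖ := by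
  have hre {z : ℂ} (hz : z ∈ upperHalf) : 0 < (realPart G z / G z).re := by
    have hlt : ‖sharp G z / G z‖ < 1 := by
      rw [norm_div, div_lt_one (norm_pos_iff.2 (hG.ne_zero (le_of_lt hz)))]
      exact hG.norm_sharp_lt hz
    rw [realPart, Pi.add_apply, add_div, div_self (hG.ne_zero (le_of_lt hz)), Complex.add_re,
      Complex.one_re]
    linarith [neg_le_of_abs_le (Complex.abs_re_le_norm (sharp G z / G z))]
  have hI : Complex.I ∈ upperHalf := by simp [upperHalf]
  obtain ⟨c, hc, hle⟩ := exists_le_re_of_re_nonneg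
    (differentiableOn_upperHalf (hG.analyticOnNhd_div (differentiable_realPart hG.entire)))
    (fun z hz => (hre hz).le) ⟨Complex.I, hI, hre hI⟩
  refine ⟨c, hc, fun z hz => ?_⟩
  rw [← le_div_iff₀ (norm_pos_iff.2 (hG.ne_zero (le_of_lt hz))), ← norm_div]
  exact (hle z hz).trans (Complex.re_le_norm _)

theorem IsRegularHB.exists_mul_max_le_norm_realPart (hG : IsRegularHB G) :
    ∃ c : ℝ, 0 < c ∧ ∀ z : ℂ,
      c * (|z.im| / (1 + ‖z‖ ^ 2)) * max ‖G z‖ ‖G (conj z)‖ ≤ ‖realPart G z‖ := by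
  obtain ⟨c, hc, hle⟩ := hG.exists_mul_norm_le_norm_realPart
  refine ⟨c, hc, fun z => ?_⟩
  rcases lt_trichotomy z.im 0 with hneg | h0 | hpos
  · have hconj : 0 < (conj z).im := by simpa using hneg
    have hmax := hG.norm_lt _ hconj
    rw [Complex.conj_conj] at hmax
    simpa only [max_eq_right hmax.le, norm_realPart_conj, Complex.norm_conj, Complex.conj_im,
      abs_of_neg hneg] using hle _ hconj
  · rw [h0, abs_zero, zero_div, mul_zero, zero_mul]
    exact norm_nonneg _
  · simpa only [max_eq_left (hG.norm_lt z hpos).le, abs_of_pos hpos] using hle z hpos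

theorem IsRegularHB.im_eq_zero_of_realPart_eq_zero (hG : IsRegularHB G) {z : ℂ}
    (hz : realPart G z = 0) : z.im = 0 := by
  obtain ⟨c, hc, hle⟩ := hG.exists_mul_max_le_norm_realPart
  by_contra him
  have hmax : 0 < max ‖G z‖ ‖G (conj z)‖ := by
    rcases lt_or_gt_of_ne him with hneg | hpos
    · exact lt_max_of_lt_right (norm_pos_iff.2 (hG.ne_zero (by simpa using hneg.le)))
    · exact lt_max_of_lt_left (norm_pos_iff.2 (hG.ne_zero hpos.le))
  refine (hle z).not_gt ?_
  rw [hz, norm_zero]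
  positivity

theorem dslope_div_dslope {z z₀ : ℂ} (hg : g z₀ = 0) (hA : A z₀ = 0) (hz : z ≠ z₀) :
    dslope g z₀ z / dslope A z₀ z = g z / A z := by
  rw [dslope_of_ne _ hz, dslope_of_ne _ hz, slope_def_field, slope_def_field, hg, hA, sub_zero,
    sub_zero, div_div_div_cancel_right₀ (sub_ne_zero.2 hz)]

theorem exists_differentiable_mul_eq (hg : Differentiable ℂ g) (hA : Differentiable ℂ A)
    (hzero : ∀ z, A z = 0 → g z = 0) (hsimple : ∀ z, A z = 0 → deriv A z ≠ 0) :
    ∃ u : ℂ → ℂ, Differentiable ℂ u ∧ ∀ z, g z = u z * A z := by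
  classical
  refine ⟨fun z => if A z = 0 then deriv g z / deriv A z else g z / A z, fun z₀ => ?_, fun z => ?_⟩
  · by_cases hz₀ : A z₀ = 0
    · have hdslope {h : ℂ → ℂ} (hh : Differentiable ℂ h) : DifferentiableAt ℂ (dslope h z₀) z₀ :=
        (analyticOnNhd_dslope (fun w _ => hh.analyticAt w) (Set.mem_univ z₀) z₀
          (Set.mem_univ z₀)).differentiableAt
      have hne : dslope A z₀ z₀ ≠ 0 := by rw [dslope_same]; exact hsimple z₀ hz₀
      refine ((hdslope hg).fun_div (hdslope hA) hne).congr_of_eventuallyEq ?_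
      filter_upwards [(hdslope hA).continuousAt.eventually_ne hne] with z hz
      rcases eq_or_ne z z₀ with rfl | hzz₀
      · rw [if_pos hz₀, dslope_same, dslope_same]
      · rw [dslope_of_ne _ hzz₀, slope_def_field, hz₀, sub_zero] at hz
        rw [if_neg (div_ne_zero_iff.1 hz).1, dslope_div_dslope (hzero z₀ hz₀) hz₀ hzz₀]
    · refine ((hg z₀).fun_div (hA z₀) hz₀).congr_of_eventuallyEq ?_
      filter_upwards [(hA z₀).continuousAt.eventually_ne hz₀] with z hz
      rw [if_neg hz]
  · by_cases hz : A z = 0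
    · rw [hz, hzero z hz, mul_zero]
    · simp only [if_neg hz, div_mul_cancel₀ _ hz]

theorem IsRegularHB.exists_norm_sq_mul_abs_im_pow_le (hG : IsRegularHB G) (hg : g ∈ space G)
    (hgu : ∀ z, g z = u z * realPart G z) :
    ∃ K : ℝ, 0 ≤ K ∧ ∀ z : ℂ, ‖u z‖ ^ 2 * |z.im| ^ 3 ≤ K * (1 + ‖z‖ ^ 2) ^ 2 := by
  obtain ⟨c, hc, hle⟩ := hG.exists_mul_max_le_norm_realPart
  have hN := normSq_nonneg G g
  refine ⟨normSq G g / c ^ 2, by positivity, fun z => ?_⟩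
  rcases eq_or_ne z.im 0 with h0 | him
  · rw [h0, abs_zero, zero_pow three_ne_zero, mul_zero]
    positivity
  have hA : 0 < ‖realPart G z‖ :=
    norm_pos_iff.2 fun hz => him (hG.im_eq_zero_of_realPart_eq_zero hz)
  have hupper := hG.norm_sq_mul_abs_im_le hg z
  rw [hgu, norm_mul] at hupper
  have hlower : (c * |z.im| * max ‖G z‖ ‖G (conj z)‖) ^ 2 ≤
      ((1 + ‖z‖ ^ 2) * ‖realPart G z‖) ^ 2 := by
    refine pow_le_pow_left₀ (by positivity) ?_ 2
    rw [mul_comm (1 + _), ← div_le_iff₀ (by positivity)]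
    exact (Eq.le (by ring)).trans (hle z)
  refine le_of_mul_le_mul_right ?_ (by positivity : 0 < c ^ 2 * ‖realPart G z‖ ^ 2)
  calc ‖u z‖ ^ 2 * |z.im| ^ 3 * (c ^ 2 * ‖realPart G z‖ ^ 2)
      = (c * |z.im|) ^ 2 * ((‖u z‖ * ‖realPart G z‖) ^ 2 * |z.im|) := by ring
    _ ≤ (c * |z.im|) ^ 2 * (max ‖G z‖ ‖G (conj z)‖ ^ 2 * normSq G g) := by gcongr
    _ = normSq G g * (c * |z.im| * max ‖G z‖ ‖G (conj z)‖) ^ 2 := by ring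
    _ ≤ normSq G g * ((1 + ‖z‖ ^ 2) * ‖realPart G z‖) ^ 2 := by gcongr
    _ = normSq G g / c ^ 2 * (1 + ‖z‖ ^ 2) ^ 2 * (c ^ 2 * ‖realPart G z‖ ^ 2) := by field_simp

theorem apply_eq_apply_zero_of_norm_sq_mul_abs_im_pow_le (hu : Differentiable ℂ u) {K : ℝ}
    (hK : 0 ≤ K) (h : ∀ z : ℂ, ‖u z‖ ^ 2 * |z.im| ^ 3 ≤ K * (1 + ‖z‖ ^ 2) ^ 2) (z : ℂ) :
    u z = u 0 := by
  refine apply_eq_apply_zero_of_norm_sq_le hu (K := 128 * K * (256 / 81)) (fun z hz => ?_) z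
  set ρ := 2 * ‖z‖ with hρ
  have hsphere (w : ℂ) (hw : ‖w‖ = ρ) :
      ‖u w‖ ^ 2 * ((2 * ρ * |w.im|) ^ 2) ^ 2 ≤ 64 * ρ ^ 9 * K := by
    have him : |w.im| ≤ ρ := hw ▸ Complex.abs_im_le_norm w
    have hle : ‖u w‖ ^ 2 * |w.im| ^ 3 ≤ K * (2 * ρ ^ 2) ^ 2 := by
      refine (h w).trans ?_
      rw [hw]
      gcongr
      nlinarith
    calc ‖u w‖ ^ 2 * ((2 * ρ * |w.im|) ^ 2) ^ 2
        = 16 * ρ ^ 4 * |w.im| * (‖u w‖ ^ 2 * |w.im| ^ 3) := by ring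
      _ ≤ 16 * ρ ^ 4 * ρ * (K * (2 * ρ ^ 2) ^ 2) :=
          mul_le_mul (by gcongr) hle (by positivity) (by positivity)
      _ = 64 * ρ ^ 9 * K := by ring
  have hmax := norm_sq_mul_le_of_sphere hu (by positivity) 2 hsphere (z := z) (by linarith)
  refine le_of_mul_le_mul_right ?_ (by positivity : 0 < ((3 * ρ ^ 2 / 4) ^ 2) ^ 2)
  calc _ ≤ 64 * ρ ^ 9 * K := hmax
    _ = _ := by rw [hρ]; ring

theorem IsRegularHB.exists_eq_smul_realPart (hG : IsRegularHB G) (hg : g ∈ space G)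
    (hsimple : ∀ x : ℝ, realPart G x = 0 → deriv (realPart G) x ≠ 0)
    (hzero : ∀ x : ℝ, realPart G x = 0 → g x = 0) : ∃ c : ℂ, g = c • realPart G := by
  have hreal {z : ℂ} (hz : realPart G z = 0) : ∃ x : ℝ, x = z :=
    ⟨z.re, Complex.ext rfl (hG.im_eq_zero_of_realPart_eq_zero hz).symm⟩
  obtain ⟨u, hu, hgu⟩ := exists_differentiable_mul_eq hg.1 (differentiable_realPart hG.entire)
    (fun z hz => by obtain ⟨x, rfl⟩ := hreal hz; exact hzero x hz)
    (fun z hz => by obtain ⟨x, rfl⟩ := hreal hz; exact hsimple x hz)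
  obtain ⟨K, hK0, hK⟩ := hG.exists_norm_sq_mul_abs_im_pow_le hg hgu
  refine ⟨u 0, funext fun z => ?_⟩
  rw [hgu, apply_eq_apply_zero_of_norm_sq_mul_abs_im_pow_le hu hK0 hK z, Pi.smul_apply, smul_eq_mul]

end Liouville

section Phase

variable {E F : ℂ → ℂ} {φ φF : ℝ → ℝ}

theorem IsPhaseFunction.div_eq (hφ : IsPhaseFunction E φ) (s t : ℝ) :
    E t / E s = ((‖E t‖ / ‖E s‖ : ℝ) : ℂ) *
      (Complex.cos ((φ s - φ t : ℝ) : ℂ) + Complex.sin ((φ s - φ t : ℝ) : ℂ) * Complex.I) := by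
  conv_lhs => rw [hφ.eq_norm_mul_exp t, hφ.eq_norm_mul_exp s]
  rw [← Complex.exp_mul_I, mul_div_mul_comm, ← Complex.exp_sub]
  push_cast
  congr 2
  ring

theorem IsPhaseFunction.hasDerivAt (hφ : IsPhaseFunction E φ) (hE : Differentiable ℂ E)
    (h0 : ∀ x : ℝ, E x ≠ 0) (x : ℝ) : HasDerivAt φ (-(deriv E x / E x).im) x := by
  have hone : E x / E x = 1 := div_self (h0 x)
  have hlog : HasDerivAt (fun t : ℝ => Complex.log (E t / E x)) (deriv E x / E x) x := by
    simpa only [hone, div_one] using ((hE x).hasDerivAt.comp_ofReal.div_const (E x)).clog_real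
      (by rw [hone]; exact Complex.one_mem_slitPlane)
  refine ((Complex.imCLM.hasFDerivAt.comp_hasDerivAt x hlog).neg.add_const
    (φ x)).congr_of_eventuallyEq ?_
  have hcont : Tendsto (fun t => φ x - φ t) (𝓝 x) (𝓝 0) := by
    simpa only [sub_self] using (hφ.continuous.tendsto x).const_sub (φ x)
  filter_upwards [hcont.eventually (Ioo_mem_nhds (neg_lt_zero.2 Real.pi_pos) Real.pi_pos)]
    with t ht
  have harg : (E t / E x).arg = φ x - φ t := by
    rw [hφ.div_eq, Complex.arg_real_mul _ (div_pos (norm_pos_iff.2 (h0 t)) (norm_pos_iff.2 (h0 x))),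
      Complex.arg_cos_add_sin_mul_I ⟨ht.1, ht.2.le⟩]
  change φ t = -(Complex.log (E t / E x)).im + φ x
  rw [Complex.log_im, harg]
  ring

theorem kernel_ofReal_self (hE : Differentiable ℂ E) (x : ℝ) :
    kernel E x x = ((-(conj (E x) * deriv E x).im / Real.pi : ℝ) : ℂ) := by
  have hsharp : HasDerivAt (sharp E) (conj (deriv E x)) x := by
    simpa only [Complex.conj_ofReal] using! (hE x).hasDerivAt.conj_conj
  have hnum : deriv (kernelNum E x) x =
      conj (E x) * deriv E x - conj (conj (E x) * deriv E x) := by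
    rw [map_mul, Complex.conj_conj]
    exact (((hE x).hasDerivAt.const_mul _).sub (hsharp.const_mul _)).deriv
  have hpi : (Real.pi : ℂ) ≠ 0 := Complex.ofReal_ne_zero.2 Real.pi_ne_zero
  have hI := Complex.I_ne_zero
  simp only [kernel_ofReal, dslope_same, hnum, Complex.sub_conj]
  push_cast
  field_simp

theorem kernel_mul_self (hE : Differentiable ℂ E) (hF : Differentiable ℂ F) (x : ℝ) :
    (kernel (fun z => E z * F z) x x).re =
      ‖F x‖ ^ 2 * (kernel E x x).re + ‖E x‖ ^ 2 * (kernel F x x).re := by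
  have hnum : conj (E x * F x) * (deriv E x * F x + E x * deriv F x) =
      ((‖F x‖ ^ 2 : ℝ) : ℂ) * (conj (E x) * deriv E x) +
        ((‖E x‖ ^ 2 : ℝ) : ℂ) * (conj (F x) * deriv F x) := by
    rw [Complex.ofReal_pow, Complex.ofReal_pow, ← Complex.conj_mul', ← Complex.conj_mul', map_mul]
    ring
  rw [kernel_ofReal_self (hE.fun_mul hF), kernel_ofReal_self hE, kernel_ofReal_self hF,
    deriv_fun_mul (hE x) (hF x), hnum]
  simp only [Complex.ofReal_re, Complex.add_im, Complex.im_ofReal_mul]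
  ring

theorem IsPhaseFunction.kernel_self (hφ : IsPhaseFunction E φ) (hE : Differentiable ℂ E)
    (h0 : ∀ x : ℝ, E x ≠ 0) (x : ℝ) :
    (kernel E x x).re = ‖E x‖ ^ 2 * deriv φ x / Real.pi := by
  have hlog : conj (E x) * deriv E x = ((‖E x‖ ^ 2 : ℝ) : ℂ) * (deriv E x / E x) := by
    rw [Complex.ofReal_pow, ← Complex.conj_mul', mul_assoc, mul_div_cancel₀ _ (h0 x)]
  rw [kernel_ofReal_self hE, (hφ.hasDerivAt hE h0 x).deriv, Complex.ofReal_re, hlog,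
    Complex.im_ofReal_mul]
  ring

theorem kernel_mul_self_le (hE : IsRegularHB E) (hF : IsRegularHB F) (hφ : IsPhaseFunction E φ)
    (hφF : IsPhaseFunction F φF) {C x : ℝ} (hC : deriv φF x ≤ C * deriv φ x) :
    (kernel (fun z => E z * F z) x x).re ≤ (1 + C) * (‖F x‖ ^ 2 * (kernel E x x).re) := by
  rw [kernel_mul_self hE.entire hF.entire, hφ.kernel_self hE.entire hE.ne_zero_ofReal,
    hφF.kernel_self hF.entire hF.ne_zero_ofReal]
  calc _ = ‖E x‖ ^ 2 * ‖F x‖ ^ 2 * (deriv φ x + deriv φF x) / Real.pi := by ring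
    _ ≤ ‖E x‖ ^ 2 * ‖F x‖ ^ 2 * (deriv φ x + C * deriv φ x) / Real.pi := by
        have := Real.pi_pos
        gcongr
    _ = _ := by ring

end Phase

section Hilbert

variable {H ι : Type*} [NormedAddCommGroup H] [InnerProductSpace ℂ H]

theorem exists_inner_sub_eq_zero [CompleteSpace H] {u : ι → H} (hu : Orthonormal ℂ u)
    {V : Submodule ℂ H} (hV : IsClosed (V : Set H)) (huV : ∀ i, u i ∈ V) (w : H) :
    ∃ s ∈ V, (∀ i, inner ℂ (u i) (w - s) = 0) ∧ ‖s‖ ^ 2 = ∑' i, ‖inner ℂ (u i) w‖ ^ 2 := by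
  classical
  have hsum : Summable fun i => inner ℂ (u i) w • u i := by
    simpa using (hu.orthogonalFamily.summable_iff_norm_sq_summable fun i => inner ℂ (u i) w).2
      (hu.inner_products_summable w)
  set s := ∑' i, inner ℂ (u i) w • u i
  have hinner (k : H) : HasSum (fun i => inner ℂ (u i) w * inner ℂ k (u i)) (inner ℂ k s) := by
    simpa only [innerSL_apply_apply, inner_smul_right] using hsum.hasSum.mapL (innerSL ℂ k)
  have hcoeff (j : ι) : inner ℂ (u j) s = inner ℂ (u j) w := by
    rw [← (hinner (u j)).tsum_eq, tsum_eq_single j fun i hij => by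
      rw [hu.inner_eq_zero hij.symm, mul_zero]]
    rw [inner_self_eq_norm_sq_to_K, hu.norm_eq_one]
    simp
  refine ⟨s, hV.mem_of_tendsto hsum.hasSum (Eventually.of_forall fun _ => V.sum_mem fun i _ =>
    V.smul_mem _ (huV i)), fun i => by rw [inner_sub_right, hcoeff, sub_self], ?_⟩
  have hnorm := hinner s
  simp only [← inner_conj_symm s (u _), hcoeff, Complex.mul_conj'] at hnorm
  rw [inner_self_eq_norm_sq_to_K] at hnorm
  exact (HasSum.tsum_eq (Complex.hasSum_ofReal.1 (by simpa using hnorm))).symm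

theorem exists_norm_le_mul_norm_sub {W L : Submodule ℂ H} (hW : IsClosed (W : Set H))
    [FiniteDimensional ℂ L] (hWL : Disjoint W L) :
    ∃ K : ℝ, 0 < K ∧ ∀ w ∈ W, ∀ l ∈ L, ‖w‖ ≤ K * ‖w - l‖ := by
  have hker : LinearMap.ker (W.mkQ.domRestrict L) = ⊥ := by
    rw [LinearMap.ker_domRestrict, W.ker_mkQ]
    exact Submodule.disjoint_iff_comap_eq_bot.1 hWL.symm
  obtain ⟨K, -, hK⟩ := LinearMap.exists_antilipschitzWith _ hker
  refine ⟨K + 1, by positivity, fun w hw l hl => ?_⟩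
  have hquot : ‖l‖ ≤ K * ‖w - l‖ := by
    have hmk : W.mkQ l = W.mkQ (l - w) := by
      rw [map_sub, show W.mkQ w = 0 by simpa using hw, sub_zero]
    calc ‖l‖ ≤ K * ‖W.mkQ l‖ := by simpa using hK.le_mul_norm_sub ⟨l, hl⟩ 0
      _ ≤ K * ‖w - l‖ := by
        rw [hmk, norm_sub_rev]
        gcongr
        exact Submodule.Quotient.norm_mk_le W _
  calc ‖w‖ ≤ ‖w - l‖ + ‖l‖ := by simpa using norm_add_le (w - l) l
    _ ≤ (K + 1) * ‖w - l‖ := by linarith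

theorem exists_mul_norm_sq_le_tsum_norm_inner_sq [CompleteSpace H] {u : ι → H}
    (hu : Orthonormal ℂ u) {V W L : Submodule ℂ H} (hV : IsClosed (V : Set H))
    (hW : IsClosed (W : Set H)) (hWV : W ≤ V) [FiniteDimensional ℂ L] (hWL : Disjoint W L)
    (huV : ∀ i, u i ∈ V) (hL : ∀ k ∈ V, (∀ i, inner ℂ (u i) k = 0) → k ∈ L) :
    ∃ A : ℝ, 0 < A ∧ ∀ w ∈ W, A * ‖w‖ ^ 2 ≤ ∑' i, ‖inner ℂ (u i) w‖ ^ 2 := by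
  obtain ⟨K, hK0, hK⟩ := exists_norm_le_mul_norm_sub hW hWL
  refine ⟨(K ^ 2)⁻¹, by positivity, fun w hw => ?_⟩
  obtain ⟨s, hsV, hperp, hnorm⟩ := exists_inner_sub_eq_zero hu hV huV w
  have hle := hK w hw _ (hL _ (V.sub_mem (hWV hw) hsV) hperp)
  rw [sub_sub_cancel] at hle
  rw [← hnorm, inv_mul_le_iff₀ (by positivity), ← mul_pow]
  gcongr

end Hilbert

section Witness

variable {E F f h b : ℂ → ℂ}

theorem sqrt_div_im_add_one_le_exp {N : ℝ} (hN : 0 ≤ N) {z : ℂ} (hz : 0 < z.im) :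
    √(N / z.im) + 1 ≤ Real.exp ((N + 1) * ((1 + ‖z‖ ^ 2) / z.im)) := by
  have him : z.im ≤ 1 + ‖z‖ ^ 2 := by nlinarith [Complex.im_le_norm z, sq_nonneg (‖z‖ - 1)]
  have hsqrt : √(N / z.im) ≤ N / z.im + 1 := by
    nlinarith [Real.sq_sqrt (div_nonneg hN hz.le), Real.sqrt_nonneg (N / z.im)]
  have hdiv : N / z.im ≤ N * ((1 + ‖z‖ ^ 2) / z.im) := by
    rw [div_eq_mul_one_div]
    gcongr
    linarith [sq_nonneg ‖z‖]
  linarith [(one_le_div hz).2 him, Real.add_one_le_exp ((N + 1) * ((1 + ‖z‖ ^ 2) / z.im))]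

theorem IsHardy.norm_sub_le_one_of_boundary (hh : IsHardy h)
    (hb : AnalyticOnNhd ℂ b {z | 0 ≤ z.im}) (hb1 : ∀ z : ℂ, 0 ≤ z.im → ‖b z‖ ≤ 1)
    (hbd : ∀ x : ℝ, ‖h x - b x‖ ≤ 1) {z : ℂ} (hz : 0 < z.im) : ‖h z - b z‖ ≤ 1 := by
  set N := ∫ t : ℝ, ‖h t‖ ^ 2
  have hN : 0 ≤ N := integral_nonneg fun _ => sq_nonneg _
  have han : AnalyticOnNhd ℂ (fun z => h z - b z) {z | 0 ≤ z.im} := hh.analyticOnNhd.sub hb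
  have hsub {w : ℂ} (hw : 0 < w.im) : ‖h w - b w‖ ≤ √(N / w.im) + 1 := by
    refine (norm_sub_le _ _).trans (add_le_add (Real.le_sqrt_of_sq_le ?_) (hb1 w hw.le))
    rw [le_div_iff₀ hw]
    exact hh.norm_sq_mul_im_le hw
  refine le_of_forall_pos_le_add fun ε hε => ?_
  have hε1 : 0 < 1 + ε := by positivity
  have hle : ‖(h z - b z) / ((1 + ε : ℝ) : ℂ)‖ ≤ 1 := by
    refine norm_le_one_of_boundary (H := fun z => (h z - b z) / ((1 + ε : ℝ) : ℂ)) (C := N + 1)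
      ((differentiableOn_upperHalf han).div_const _) (by positivity) (fun w hw => ?_)
      (fun x => ?_) (fun δ hδ => ?_) hz
    · rw [norm_div, Complex.norm_real, Real.norm_of_nonneg hε1.le]
      exact (div_le_self (norm_nonneg _) (by linarith)).trans
        ((hsub hw).trans (sqrt_div_im_add_one_le_exp hN hw))
    · have hcont : ContinuousAt (fun z => ‖(h z - b z) / ((1 + ε : ℝ) : ℂ)‖) x :=
        ((han x (by simp)).continuousAt.div_const _).norm
      refine ((hcont.eventually_lt continuousAt_const ?_).filter_mono nhdsWithin_le_nhds).mono
        fun _ => le_of_lt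
      rw [norm_div, Complex.norm_real, Real.norm_of_nonneg hε1.le, div_lt_one hε1]
      linarith [hbd x]
    · filter_upwards [eventually_gt_atTop 0, eventually_ge_atTop (N / ε ^ 2)] with y hy hyN
      have hsqrt : √(N / y) ≤ ε := by
        refine Real.sqrt_le_iff.2 ⟨hε.le, ?_⟩
        rwa [div_le_comm₀ hy (by positivity)]
      have hIy := hsub (I_mul_ofReal_mem_upperHalf hy)
      simp only [Complex.mul_im, Complex.I_re, Complex.I_im, Complex.ofReal_re, Complex.ofReal_im,
        zero_mul, one_mul, zero_add] at hIy
      rw [norm_div, Complex.norm_real, Real.norm_of_nonneg hε1.le]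
      exact ((div_le_one hε1).2 (by linarith)).trans (Real.one_le_exp (by positivity))
  rwa [norm_div, Complex.norm_real, Real.norm_of_nonneg hε1.le, div_le_one hε1] at hle

theorem IsRegularHB.mul_ne_realPart_mul (hE : IsRegularHB E) (hF : IsRegularHB F)
    (hf : f ∈ space E) : (fun z => f z * F z) ≠ realPart fun z => E z * F z := by
  intro heq
  have hprod {z : ℂ} (hz : 0 ≤ z.im) :
      (sharp f z / E z - sharp E z / E z) * (sharp F z / F z) = 1 := by
    have hsharp : sharp f z * sharp F z = E z * F z + sharp E z * sharp F z := by
      rw [← realPart_mul, ← sharp_realPart, ← heq, sharp_mul]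
    field_simp [hE.ne_zero hz, hF.ne_zero hz]
    linear_combination hsharp
  have hI : 0 < Complex.I.im := by simp
  have hle := (hE.mem_space_iff.1 hf).2.2.norm_sub_le_one_of_boundary
    (hE.analyticOnNhd_div (differentiable_sharp hE.entire))
    (fun z hz => by
      rw [norm_div]
      exact div_le_one_of_le₀ (hE.norm_sharp_le hz) (norm_nonneg _))
    (fun x => ?_) hI
  · have hlt : ‖sharp F Complex.I / F Complex.I‖ < 1 := by
      rw [norm_div, div_lt_one (norm_pos_iff.2 (hF.ne_zero hI.le))]
      exact hF.norm_sharp_lt hI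
    have hone := congrArg norm (hprod hI.le)
    rw [norm_mul, norm_one] at hone
    nlinarith [norm_nonneg (sharp F Complex.I / F Complex.I)]
  · have hone := congrArg norm (hprod (z := x) (by simp))
    rw [norm_mul, norm_sharp_div_ofReal, div_self (hF.ne_zero_ofReal x), norm_one,
      mul_one] at hone
    exact hone.le

end Witness

section KernelVector

variable {G g : ℂ → ℂ}

/-- The reproducing kernel of `G` at the real point `x`, seen in `L²(ℝ)` through the embedding
`IsRegularHB.toL2`. -/
noncomputable def IsRegularHB.kernelVec (hG : IsRegularHB G) (x : ℝ) :
    Lp ℂ 2 (volume : Measure ℝ) :=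
  hG.toL2 ⟨kernel G x, hG.kernel_mem_space x⟩

theorem IsRegularHB.inner_kernelVec (hG : IsRegularHB G) (x : ℝ) (g : hG.submodule) :
    inner ℂ (hG.kernelVec x) (hG.toL2 g) = g.1 x := by
  rw [kernelVec, hG.inner_toL2]
  exact hG.integral_conj_kernel_mul g.2 x

theorem IsRegularHB.inner_kernelVec_kernelVec (hG : IsRegularHB G) (x y : ℝ) :
    inner ℂ (hG.kernelVec x) (hG.kernelVec y) = kernel G y x :=
  hG.inner_kernelVec x ⟨kernel G y, hG.kernel_mem_space y⟩

theorem IsRegularHB.norm_kernelVec_sq (hG : IsRegularHB G) (x : ℝ) :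
    ‖hG.kernelVec x‖ ^ 2 = (kernel G x x).re := by
  rw [← inner_self_eq_norm_sq (𝕜 := ℂ), inner_kernelVec_kernelVec]
  rfl

theorem IsRegularHB.kernel_self_nonneg (hG : IsRegularHB G) (x : ℝ) : 0 ≤ (kernel G x x).re :=
  hG.norm_kernelVec_sq x ▸ sq_nonneg _

theorem IsRegularHB.norm_sq_le_kernel_mul_normSq (hG : IsRegularHB G) (hg : g ∈ space G) (x : ℝ) :
    ‖g x‖ ^ 2 ≤ (kernel G x x).re * normSq G g := by
  have hcs := norm_inner_le_norm (𝕜 := ℂ) (hG.kernelVec x) (hG.toL2 ⟨g, hg⟩)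
  rw [inner_kernelVec] at hcs
  rw [← hG.norm_kernelVec_sq, ← hG.norm_toL2_sq ⟨g, hg⟩, ← mul_pow]
  gcongr

theorem IsRegularHB.normSq_kernel (hG : IsRegularHB G) (x : ℝ) :
    normSq G (kernel G x) = (kernel G x x).re := by
  rw [← hG.norm_kernelVec_sq]
  exact (hG.norm_toL2_sq ⟨kernel G x, hG.kernel_mem_space x⟩).symm

end KernelVector

section SameSpace

variable {G₁ G₂ : ℂ → ℂ}

theorem SameSpace.symm (h : SameSpace G₁ G₂) : SameSpace G₂ G₁ := by
  obtain ⟨heq, a, b, ha, hb, hab⟩ := h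
  refine ⟨heq.symm, b⁻¹, a⁻¹, inv_pos.2 hb, inv_pos.2 ha, fun f hf => ?_⟩
  obtain ⟨hle, hge⟩ := hab f (heq ▸ hf)
  exact ⟨(inv_mul_le_iff₀ hb).2 hge, (le_inv_mul_iff₀ ha).2 hle⟩

theorem SameSpace.exists_kernel_self_le (h : SameSpace G₁ G₂) (h₁ : IsRegularHB G₁)
    (h₂ : IsRegularHB G₂) :
    ∃ c : ℝ, 0 < c ∧ ∀ x : ℝ, (kernel G₁ x x).re ≤ c * (kernel G₂ x x).re := by
  obtain ⟨heq, a, b, -, hb, hab⟩ := h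
  refine ⟨b, hb, fun x => ?_⟩
  have hmem := h₁.kernel_mem_space x
  have hle : (kernel G₁ x x).re ^ 2 ≤ (kernel G₂ x x).re * (b * (kernel G₁ x x).re) :=
    calc (kernel G₁ x x).re ^ 2 ≤ ‖kernel G₁ x x‖ ^ 2 := by
          rw [sq_le_sq, abs_norm]
          exact Complex.abs_re_le_norm _
      _ ≤ (kernel G₂ x x).re * normSq G₂ (kernel G₁ x) :=
          h₂.norm_sq_le_kernel_mul_normSq (heq ▸ hmem) x
      _ ≤ _ := by
          rw [← h₁.normSq_kernel]
          exact mul_le_mul_of_nonneg_left (hab _ hmem).2 (h₂.kernel_self_nonneg x)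
  rcases (h₁.kernel_self_nonneg x).eq_or_lt with h0 | hpos
  · rw [← h0]
    exact mul_nonneg hb.le (h₂.kernel_self_nonneg x)
  · nlinarith

theorem SameSpace.isSamplingSequence {ι : Type*} {s : ι → ℝ} (h : SameSpace G₁ G₂)
    (hs : IsSamplingSequence G₂ s) : IsSamplingSequence G₁ s := by
  obtain ⟨heq, a, b, ha, hb, hab⟩ := h
  obtain ⟨A, B, hA, hB, hAB⟩ := hs
  refine ⟨A * a, B * b, by positivity, by positivity, fun f hf => ?_⟩
  obtain ⟨hsum, hlower, hupper⟩ := hAB f (heq ▸ hf)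
  obtain ⟨hle, hge⟩ := hab f hf
  refine ⟨hsum, ?_, ?_⟩
  · rw [mul_assoc]
    exact (mul_le_mul_of_nonneg_left hle hA.le).trans hlower
  · rw [mul_assoc]
    exact hupper.trans (mul_le_mul_of_nonneg_left hge hB.le)

end SameSpace

section Sampling

variable {ι : Type*} {G E F f : ℂ → ℂ} {s : ι → ℝ}

theorem kernelNum_of_realPart_eq_zero {x : ℝ} (hx : realPart G x = 0) :
    kernelNum G x = fun z => -G x * realPart G z := by
  funext z
  rw [realPart, Pi.add_apply, sharp_ofReal] at hx
  rw [kernelNum, realPart, Pi.add_apply, eq_neg_of_add_eq_zero_right hx]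
  ring

theorem deriv_realPart_ne_zero {x : ℝ} (hx : realPart G x = 0) (hK : kernel G x x ≠ 0) :
    deriv (realPart G) x ≠ 0 := by
  contrapose! hK
  simp only [kernel_ofReal, dslope_same]
  rw [kernelNum_of_realPart_eq_zero hx, deriv_const_mul_field, hK,
    mul_zero, neg_zero, zero_div]

theorem kernel_eq_zero_of_realPart_eq_zero {x y : ℝ} (hx : realPart G x = 0)
    (hy : realPart G y = 0) (hxy : x ≠ y) : kernel G x y = 0 := by
  have hker := kernel_mul G x y
  simp only [kernelNum_of_realPart_eq_zero hx, hy, mul_zero] at hker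
  exact (mul_eq_zero.1 hker).resolve_right
    (mul_ne_zero Complex.two_pi_I_ne_zero (sub_ne_zero.2 (by exact_mod_cast hxy)))

/-- The reproducing kernel at `x`, normalized in `L²(ℝ)`; it is zero if `K_G(x, x) = 0`. -/
noncomputable def IsRegularHB.unitKernel (hG : IsRegularHB G) (x : ℝ) :
    Lp ℂ 2 (volume : Measure ℝ) :=
  ((‖hG.kernelVec x‖⁻¹ : ℝ) : ℂ) • hG.kernelVec x

theorem IsRegularHB.unitKernel_mem_range (hG : IsRegularHB G) (x : ℝ) :
    hG.unitKernel x ∈ LinearMap.range hG.toL2 :=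
  Submodule.smul_mem _ _ (LinearMap.mem_range_self _ _)

theorem IsRegularHB.inner_unitKernel (hG : IsRegularHB G) (x : ℝ) (g : hG.submodule) :
    inner ℂ (hG.unitKernel x) (hG.toL2 g) = ((‖hG.kernelVec x‖⁻¹ : ℝ) : ℂ) * g.1 x := by
  rw [unitKernel, inner_smul_left, Complex.conj_ofReal, inner_kernelVec]

theorem IsRegularHB.norm_inner_unitKernel_sq (hG : IsRegularHB G) (x : ℝ) (g : hG.submodule) :
    ‖inner ℂ (hG.unitKernel x) (hG.toL2 g)‖ ^ 2 = ‖g.1 x‖ ^ 2 / (kernel G x x).re := by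
  rw [inner_unitKernel, norm_mul, mul_pow, Complex.norm_real, norm_inv, norm_norm, inv_pow,
    norm_kernelVec_sq, inv_mul_eq_div]

theorem IsRegularHB.orthonormal_unitKernel (hG : IsRegularHB G) (hs : Function.Injective s)
    (hzero : ∀ i, realPart G (s i) = 0) (hK : ∀ i, 0 < (kernel G (s i) (s i)).re) :
    Orthonormal ℂ fun i => hG.unitKernel (s i) := by
  refine ⟨fun i => ?_, fun i j hij => ?_⟩
  · have hne : ‖hG.kernelVec (s i)‖ ≠ 0 := by
      rw [← sq_pos_iff, norm_kernelVec_sq]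
      exact hK i
    simp only [unitKernel]
    rw [norm_smul, Complex.norm_real, norm_inv, norm_norm, inv_mul_cancel₀ hne]
  · have hker := kernel_eq_zero_of_realPart_eq_zero (hzero j) (hzero i) (hs.ne hij.symm)
    simp only [unitKernel, inner_smul_left, inner_smul_right, inner_kernelVec_kernelVec, hker,
      mul_zero]

/-- The multiples of `G + G*` that lie in the de Branges space of `G`, seen in `L²(ℝ)`. -/
noncomputable def IsRegularHB.realPartLine (hG : IsRegularHB G) :
    Submodule ℂ (Lp ℂ 2 (volume : Measure ℝ)) :=
  ((ℂ ∙ realPart G).comap hG.submodule.subtype).map hG.toL2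

instance IsRegularHB.finiteDimensional_realPartLine (hG : IsRegularHB G) :
    FiniteDimensional ℂ hG.realPartLine := by
  have : FiniteDimensional ℂ ((ℂ ∙ realPart G).comap hG.submodule.subtype) :=
    Module.Finite.of_injective (hG.submodule.subtype.restrict (q := ℂ ∙ realPart G) fun _ => id)
      fun f g hfg => Subtype.ext (Subtype.ext (by simpa using congrArg Subtype.val hfg))
  exact inferInstanceAs (FiniteDimensional ℂ (Submodule.map hG.toL2 _))

theorem IsRegularHB.mem_realPartLine (hG : IsRegularHB G)
    (hzero : ∀ x : ℝ, realPart G x = 0 → x ∈ Set.range s)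
    (hK : ∀ i, 0 < (kernel G (s i) (s i)).re) {k : Lp ℂ 2 (volume : Measure ℝ)}
    (hk : k ∈ LinearMap.range hG.toL2) (hperp : ∀ i, inner ℂ (hG.unitKernel (s i)) k = 0) :
    k ∈ hG.realPartLine := by
  obtain ⟨g, rfl⟩ := hk
  have hg (x : ℝ) (hx : realPart G x = 0) : g.1 x = 0 := by
    obtain ⟨i, rfl⟩ := hzero x hx
    have hsq := hG.norm_inner_unitKernel_sq (s i) g
    rw [hperp, norm_zero, zero_pow two_ne_zero, eq_comm, div_eq_zero_iff] at hsq
    simpa using hsq.resolve_right (hK i).ne'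
  have hsimple (x : ℝ) (hx : realPart G x = 0) : deriv (realPart G) x ≠ 0 := by
    obtain ⟨i, rfl⟩ := hzero x hx
    exact deriv_realPart_ne_zero hx fun h0 => (hK i).ne' (by rw [h0, Complex.zero_re])
  obtain ⟨c, hc⟩ := hG.exists_eq_smul_realPart g.2 hsimple hg
  exact Submodule.mem_map_of_mem (Submodule.mem_span_singleton.2 ⟨c, hc.symm⟩)

theorem IsRegularHB.toL2_mul (hE : IsRegularHB E) (hF : IsRegularHB F) (hf : f ∈ space E) :
    (hE.mul hF).toL2 ⟨fun z => f z * F z, hE.mul_mem_space hF hf⟩ = hE.toL2 ⟨f, hf⟩ :=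
  MemLp.toLp_congr ((hE.mul hF).memLp (hE.mul_mem_space hF hf)) (hE.memLp hf)
    (Eventually.of_forall fun t => mul_div_mul_right _ _ (hF.ne_zero_ofReal t))

theorem IsRegularHB.range_toL2_le_range_toL2_mul (hE : IsRegularHB E) (hF : IsRegularHB F) :
    LinearMap.range hE.toL2 ≤ LinearMap.range (hE.mul hF).toL2 := by
  rintro _ ⟨⟨f, hf⟩, rfl⟩
  exact ⟨_, hE.toL2_mul hF hf⟩

theorem IsRegularHB.toL2_injective (hG : IsRegularHB G) : Function.Injective hG.toL2 := by
  refine (injective_iff_map_eq_zero _).2 fun g hg => Subtype.ext (funext fun z => ?_)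
  obtain ⟨C, -, hC⟩ := hG.exists_norm_sq_le (R := ‖z‖ + 1) (by positivity)
  have hle := hC g.1 g.2 z (by linarith)
  rw [← hG.norm_toL2_sq, hg] at hle
  simpa using hle

theorem IsRegularHB.disjoint_range_toL2_realPartLine (hE : IsRegularHB E) (hF : IsRegularHB F) :
    Disjoint (LinearMap.range hE.toL2) (hE.mul hF).realPartLine := by
  rw [Submodule.disjoint_def]
  rintro _ ⟨⟨f, hf⟩, rfl⟩ ⟨g, hspan, heq⟩
  have hg : g.1 = fun z => f z * F z :=
    congrArg Subtype.val ((hE.mul hF).toL2_injective (heq.trans (hE.toL2_mul hF hf).symm))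
  obtain ⟨c, hc : c • realPart _ = g.1⟩ := Submodule.mem_span_singleton.1 hspan
  obtain rfl | hc0 := eq_or_ne c 0
  · rw [zero_smul] at hc
    rw [← heq, show g = 0 from Subtype.ext hc.symm, map_zero]
  · refine absurd ?_ (hE.mul_ne_realPart_mul hF (hE.submodule.smul_mem c⁻¹ hf))
    rw [← inv_smul_smul₀ hc0 (realPart _), hc, hg]
    funext z
    exact mul_assoc _ _ _

theorem IsRegularHB.exists_mul_normSq_le_tsum (hE : IsRegularHB E) (hF : IsRegularHB F)
    (hs : Function.Injective s)
    (hrange : Set.range s = {x : ℝ | realPart (fun z => E z * F z) x = 0})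
    (hK : ∀ i, 0 < (kernel (fun z => E z * F z) (s i) (s i)).re) :
    ∃ A : ℝ, 0 < A ∧ ∀ f ∈ space E, A * normSq E f ≤
      ∑' i, ‖f (s i) * F (s i)‖ ^ 2 / (kernel (fun z => E z * F z) (s i) (s i)).re := by
  have hG := hE.mul hF
  obtain ⟨A, hA, hle⟩ := exists_mul_norm_sq_le_tsum_norm_inner_sq
    (hG.orthonormal_unitKernel hs (fun i => hrange.subset ⟨i, rfl⟩) hK)
    hG.isClosed_range_toL2 hE.isClosed_range_toL2 (hE.range_toL2_le_range_toL2_mul hF)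
    (hE.disjoint_range_toL2_realPartLine hF) (fun i => hG.unitKernel_mem_range (s i))
    fun k => hG.mem_realPartLine hrange.superset hK
  refine ⟨A, hA, fun f hf => ?_⟩
  have hf' := hle _ (LinearMap.mem_range_self hE.toL2 ⟨f, hf⟩)
  rw [hE.norm_toL2_sq, ← hE.toL2_mul hF hf] at hf'
  simpa only [hG.norm_inner_unitKernel_sq] using hf'

theorem IsRegularHB.summable_and_tsum_le_normSq (hG : IsRegularHB G)
    (hs : Function.Injective s) (hzero : ∀ i, realPart G (s i) = 0)
    (hK : ∀ i, 0 < (kernel G (s i) (s i)).re) (hg : f ∈ space G) :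
    Summable (fun i => ‖f (s i)‖ ^ 2 / (kernel G (s i) (s i)).re) ∧
      ∑' i, ‖f (s i)‖ ^ 2 / (kernel G (s i) (s i)).re ≤ normSq G f := by
  have hu := hG.orthonormal_unitKernel hs hzero hK
  have hsum := hu.inner_products_summable (hG.toL2 ⟨f, hg⟩)
  have hle := hu.tsum_inner_products_le (hG.toL2 ⟨f, hg⟩)
  simp only [hG.norm_inner_unitKernel_sq, hG.norm_toL2_sq] at hsum hle
  exact ⟨hsum, hle⟩

theorem IsRegularHB.normSq_mul (hE : IsRegularHB E) (hF : IsRegularHB F) (hf : f ∈ space E) :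
    normSq (fun z => E z * F z) (fun z => f z * F z) = normSq E f := by
  rw [← hE.norm_toL2_sq ⟨f, hf⟩, ← hE.toL2_mul hF hf, (hE.mul hF).norm_toL2_sq]

theorem summable_and_tsum_le_of_mul_le {p q : ι → ℝ} (hq : Summable q) (hp : ∀ i, 0 ≤ p i)
    {m M : ℝ} (hmq : ∀ i, m * q i ≤ p i) (hMq : ∀ i, p i ≤ M * q i) :
    Summable p ∧ m * ∑' i, q i ≤ ∑' i, p i ∧ ∑' i, p i ≤ M * ∑' i, q i := by
  have hsum : Summable p := .of_nonneg_of_le hp hMq (hq.mul_left M)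
  rw [← tsum_mul_left, ← tsum_mul_left]
  exact ⟨hsum, (hq.mul_left m).tsum_le_tsum hmq hsum, hsum.tsum_le_tsum hMq (hq.mul_left M)⟩

theorem IsRegularHB.isSamplingSequence_of_kernel_le (hE : IsRegularHB E) (hF : IsRegularHB F)
    (hs : Function.Injective s)
    (hrange : Set.range s = {x : ℝ | realPart (fun z => E z * F z) x = 0})
    {m M : ℝ} (hm : 0 < m)
    (hmK : ∀ x : ℝ, m * ‖F x‖ ^ 2 ≤ (kernel (fun z => E z * F z) x x).re)
    (hKM : ∀ x : ℝ, (kernel (fun z => E z * F z) x x).re ≤ M * ‖F x‖ ^ 2) :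
    IsSamplingSequence E s := by
  have hF0 (x : ℝ) : 0 < ‖F x‖ ^ 2 := pow_pos (norm_pos_iff.2 (hF.ne_zero_ofReal x)) 2
  have hK (x : ℝ) : 0 < (kernel (fun z => E z * F z) x x).re :=
    (mul_pos hm (hF0 x)).trans_le (hmK x)
  have hM : 0 < M := (mul_pos_iff_of_pos_right (hF0 0)).1 ((hK 0).trans_le (hKM 0))
  obtain ⟨A, hA, hlower⟩ := hE.exists_mul_normSq_le_tsum hF hs hrange fun i => hK (s i)
  refine ⟨m * A, M, by positivity, hM, fun f hf => ?_⟩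
  obtain ⟨hsum, hupper⟩ := (hE.mul hF).summable_and_tsum_le_normSq hs
    (fun i => hrange.subset ⟨i, rfl⟩) (fun i => hK (s i)) (hE.mul_mem_space hF hf)
  rw [hE.normSq_mul hF hf] at hupper
  obtain ⟨hsumf, hge, hle⟩ := summable_and_tsum_le_of_mul_le hsum
    (p := fun i => ‖f (s i)‖ ^ 2) (fun _ => sq_nonneg _) (m := m) (M := M) (fun i => by
      rw [mul_div_assoc', div_le_iff₀ (hK _), norm_mul, mul_pow, mul_left_comm]
      exact mul_le_mul_of_nonneg_left (hmK _) (sq_nonneg _)) (fun i => by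
      rw [mul_div_assoc', le_div_iff₀ (hK _), norm_mul, mul_pow, mul_left_comm]
      exact mul_le_mul_of_nonneg_left (hKM _) (sq_nonneg _))
  refine ⟨hsumf, ?_, hle.trans (mul_le_mul_of_nonneg_left hupper hM.le)⟩
  rw [mul_assoc]
  exact (mul_le_mul_of_nonneg_left (hlower f hf) hm.le).trans hge

theorem IsPhaseFunction.isSamplingSequence (hE : IsRegularHB E) (hF : IsRegularHB F)
    {φ φF : ℝ → ℝ} (hφ : IsPhaseFunction E φ) (hφF : IsPhaseFunction F φF)
    (hs : Function.Injective s)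
    (hrange : Set.range s = {x : ℝ | realPart (fun z => E z * F z) x = 0})
    {C a b : ℝ} (hC0 : 0 ≤ C) (hC : ∀ x, deriv φF x ≤ C * deriv φ x) (ha : 0 < a)
    (haK : ∀ x : ℝ, a ≤ (kernel E x x).re) (hKb : ∀ x : ℝ, (kernel E x x).re ≤ b) :
    IsSamplingSequence E s := by
  refine hE.isSamplingSequence_of_kernel_le hF hs hrange ha (M := (1 + C) * b)
    (fun x => ?_) fun x => ?_
  · rw [kernel_mul_self hE.entire hF.entire, mul_comm a]
    exact le_add_of_le_of_nonneg (mul_le_mul_of_nonneg_left (haK x) (sq_nonneg _))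
      (mul_nonneg (sq_nonneg _) (hF.kernel_self_nonneg x))
  · refine (kernel_mul_self_le hE hF hφ hφF (hC x)).trans ?_
    rw [mul_assoc, mul_comm b]
    gcongr
    exact hKb x

end Sampling

end DeBranges

theorem mainTheorem10 (E₀ E F : ℂ → ℂ)
    (hE₀ : DeBranges.IsHermiteBiehler E₀) (hE : DeBranges.IsHermiteBiehler E)
    (hF : DeBranges.IsHermiteBiehler F)
    (hE₀_real : ∀ x : ℝ, E₀ x ≠ 0) (hE_real : ∀ x : ℝ, E x ≠ 0) (hF_real : ∀ x : ℝ, F x ≠ 0)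
    (hsame : DeBranges.SameSpace E₀ E)
    (φE φF : ℝ → ℝ)
    (hφE : DeBranges.IsPhaseFunction E φE) (hφF : DeBranges.IsPhaseFunction F φF)
    (hφ : ∃ C : ℝ, 0 < C ∧ ∀ x : ℝ, deriv φF x ≤ C * deriv φE x)
    (hK : ∃ a b : ℝ, 0 < a ∧ 0 < b ∧ ∀ x : ℝ,
      a ≤ (DeBranges.kernel E₀ x x).re ∧ (DeBranges.kernel E₀ x x).re ≤ b) :
    (∀ z : ℂ, E z * F z + DeBranges.sharp E z * DeBranges.sharp F z = 0 → z.im = 0) ∧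
      DeBranges.IsSamplingSequence E₀
        (fun x : {x : ℝ // E (x : ℂ) * F (x : ℂ) +
          DeBranges.sharp E (x : ℂ) * DeBranges.sharp F (x : ℂ) = 0} => (x : ℝ)) := by
  have h₀ : DeBranges.IsRegularHB E₀ := ⟨hE₀, hE₀_real⟩
  have h₁ : DeBranges.IsRegularHB E := ⟨hE, hE_real⟩
  have h₂ : DeBranges.IsRegularHB F := ⟨hF, hF_real⟩
  obtain ⟨C, hC, hle⟩ := hφ
  obtain ⟨a, b, ha, -, hab⟩ := hK
  obtain ⟨c, hc, hlower⟩ := hsame.exists_kernel_self_le h₀ h₁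
  obtain ⟨d, hd, hupper⟩ := hsame.symm.exists_kernel_self_le h₁ h₀
  have hKa (x : ℝ) : a / c ≤ (DeBranges.kernel E x x).re :=
    (div_le_iff₀' hc).2 ((hab x).1.trans (hlower x))
  have hKb (x : ℝ) : (DeBranges.kernel E x x).re ≤ d * b :=
    (hupper x).trans (mul_le_mul_of_nonneg_left (hab x).2 hd.le)
  refine ⟨fun z hz => (h₁.mul h₂).im_eq_zero_of_realPart_eq_zero
    ((DeBranges.realPart_mul E F z).trans hz), hsame.isSamplingSequence ?_⟩
  refine hφE.isSamplingSequence h₁ h₂ hφF Subtype.val_injective ?_ hC.le hle (div_pos ha hc) hKa hKb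
  simp only [DeBranges.realPart_mul]
  exact Subtype.range_coe_subtype
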